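/- **Conventions.** All manifolds, maps and forms are smooth and real, and manifolds are finite dimensional, Hausdorff, second countable and without boundary. A *Pfaffian system* on a manifold $M$ is a constant rank smooth subbundle $I\subset T^*M$, and $\operatorname{ann}(I)\subset TM$ denotes its annihilator. An *integral manifold* of $I$ is an immersion $s:N\to M$ with $s^*I=0$. The derived system $I'$ is spanned pointwise by the values of the local sections $\theta$ of $I$ with $d\theta\equiv 0 \bmod I$, and $I^\infty$ is spanned pointwise by the differentials $dF$ of local functions $F$ with $dF\in I$. The system $I$ is *decomposable*, with constants $n_1,p_1,n_2,p_2\ge 1$ and singular systems $\hat V,\check V$, if about each point there is a coframe consisting of families $\theta^{i_0},\theta^{i_1},\theta^{i_2}$, $\hat\tau^a$ $(1\le a\le p_1)$, $\hat\omega^b$ $(1\le b\le n_1)$, $\check\tau^\alpha$ $(1\le\alpha\le p_2)$, $\check\omega^\beta$ $(1\le\beta\le n_2)$ such that, $\theta^i$ denoting all the $\theta$'s together, $I=\operatorname{span}\{\theta^{i}\}$, $I'=\operatorname{span}\{\theta^{i_0}\}$, $\hat V=\operatorname{span}\{\theta^i,\hat\tau^a,\hat\omega^b\}$, $\check V=\operatorname{span}\{\theta^i,\check\tau^\alpha,\check\omega^\beta\}$,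 and, modulo $I$, $$d\theta^{i_0}\equiv 0,\qquad d\theta^{i_1}\equiv A^{i_1}_{ab}\,\hat\tau^a\wedge\hat\omega^b,\qquad d\theta^{i_2}\equiv B^{i_2}_{\alpha\beta}\,\check\tau^\alpha\wedge\check\omega^\beta .$$ It is *Darboux integrable* if $I^\infty=0$ and $\hat V+\check V^\infty=T^*M=\hat V^\infty+\check V$. A *canonical quotient representation* of $I$ consists of manifolds $M_1,M_2$ with Pfaffian systems $K_1,K_2$ satisfying $K_i^\infty=0$, and a Lie group $G$ acting (possibly only locally) on $M_1$ and $M_2$, freely and regularly (with submersive quotient maps $\mathbf q_i:M_i\to M_i/G$), as symmetry group of $K_1$ and of $K_2$ and transversally to them, i.e. $\ker(\mathbf q_{i*})\cap\operatorname{ann}(K_i)=0$, such that the diagonal action on $M_1\times M_2$ is regular with quotient map $\mathbf q_{G_{\mathrm{diag}}}:M_1\times M_2\to (M_1\times M_2)/G_{\mathrm{diag}}=M$ and transverse to $K_1'+K_2'$, and such that $$I=(K_1+K_2)/G_{\mathrm{diag}},\qquad \hat V=(K_1+T^*M_2)/G_{\mathrm{diag}},\qquad \check V=(T^*M_1+K_2)/G_{\mathrm{diag}}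 .$$ Here $K_1+K_2=\pi_1^*K_1+\pi_2^*K_2$, where $\pi_i:M_1\times M_2\to M_i$ are the projections, and the quotient of a system consists of the covectors on $M$ whose pullback by $\mathbf q_{G_{\mathrm{diag}}}$ lies in the system. An integral manifold $S$ of $I$ of dimension $n_1+n_2-1$ is *non-characteristic* if, for every $x\in S$, $$\dim\big(T_xS\cap\operatorname{ann}(\hat V)_x\big)=n_2-1,\qquad \dim\big(T_xS\cap\operatorname{ann}(\check V)_x\big)=n_1-1 .$$ (For curves, $n_1=n_2=1$, this says that the velocity lies neither in $\operatorname{ann}(\hat V)$ nor in $\operatorname{ann}(\check V)$.) A map $s:N\to M$ *solves the local Cauchy problem for $I$ about $x_0\in S$ with Cauchy data $S$* if $s$ is an integral manifold of $I$ with $\dim N=n_1+n_2$, and there is an open neighbourhood $U$ of $x_0$ such that the restriction $s:s^{-1}(U)\to U$ satisfies $S\cap U\subset s(s^{-1}(U))$. **Theorem.** Let $I$ be a decomposable Darboux integrable Pfaffian system on $M$ with a canonical quotient representation as above. Let $S\subset M$ be an embedded non-characteristic integral manifold of $I$ of dimension $n_1+n_2-1$. Let $x_0\in S$, let $(x_1,x_2)\in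 M_1\times M_2$ satisfy $\mathbf q_{G_{\mathrm{diag}}}(x_1,x_2)=x_0$, and let $L\subset M_1\times M_2$ be a lift of $S$ through $(x_1,x_2)$ to an integral manifold of $K_1+K_2$: the maximal integral manifold through $(x_1,x_2)$ of the restriction of $K_1+K_2$ to $P=\mathbf q_{G_{\mathrm{diag}}}^{-1}(S)$ or, more generally, any immersed integral manifold of $K_1+K_2$ through $(x_1,x_2)$ that is contained in $P$ and has tangent spaces $T_yL=\operatorname{ann}(K_1+K_2)_y\cap T_yP$. Put $L_i=\pi_i(L)$. Then $L_1$ and $L_2$ are, locally on $L$, embedded integral manifolds of $K_1$ and $K_2$ of dimensions $n_2$ and $n_1$: every point of $L$ has open neighbourhoods $A_1,A_2$ in $L$ such that $\pi_1(A_1)$ is an embedded $n_2$-dimensional integral manifold of $K_1$ and $\pi_2(A_2)$ is an embedded $n_1$-dimensional integral manifold of $K_2$, each of them diffeomorphic to a Euclidean space. With these local manifold structures, the map $$s:L_1\times L_2\to M,\qquad s(t_1,t_2)=\mathbf q_{G_{\mathrm{diag}}}(t_1,t_2),$$ is an $(n_1+n_2)$-dimensional integral manifold of $I$ (i.e. it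 is one on each product of a piece $\pi_1(A_1)$ and a piece $\pi_2(A_2)$, the pieces belonging to arbitrary, possibly different, points of $L$), and it solves the local Cauchy problem for $I$ about $x_0$ with Cauchy data $S$; more precisely, its restriction to $\pi_1(A_1)\times\pi_2(A_2)$, where $A_1,A_2$ are the neighbourhoods of the point $(x_1,x_2)$ of $L$, does. The same holds about $\mathbf q_{G_{\mathrm{diag}}}(y)$ for every $y\in L$. -/

import Mathlib

open scoped Manifold ContDiff Topology

noncomputable section

namespace DarbouxCauchy

section Systems

variable {E H M : Type*} [NormedAddCommGroup E] [NormedSpace ℝ E] [TopologicalSpace H]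
  (I : ModelWithCorners ℝ E H) [TopologicalSpace M] [ChartedSpace H M]

/-- The cotangent space at `x`. -/
abbrev Cotangent (x : M) : Type _ := TangentSpace I x →L[ℝ] ℝ

/-- Differential one-forms (no regularity imposed). -/
abbrev OneForm (M : Type*) [TopologicalSpace M] [ChartedSpace H M] : Type _ :=
  ∀ x : M, Cotangent I x

/-- A field of linear subspaces of the cotangent spaces of `M`. A Pfaffian system is such a field
which is a smooth subbundle, see `IsPfaffian`. -/
abbrev CoDistribution (M : Type*) [TopologicalSpace M] [ChartedSpace H M] : Type _ :=
  ∀ x : M, Submodule ℝ (Cotangent I x)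

variable {I}

/-- The one-form `θ` read in the preferred chart at `x`, i.e. its pullback under the inverse of
that chart: a function on the model space with values in the dual of the model space. -/
def OneForm.inChart (θ : OneForm I M) (x : M) : E → (E →L[ℝ] ℝ) := fun y =>
  (θ ((extChartAt I x).symm y)).comp (mfderiv 𝓘(ℝ, E) I (extChartAt I x).symm y)

/-- Smoothness of a one-form on a set (used for open sets only), on a manifold without boundary. -/
def OneForm.SmoothOn (θ : OneForm I M) (U : Set M) : Prop :=
  ∀ x ∈ U, ContDiffAt ℝ ∞ (θ.inChart x) (extChartAt I x x)

/-- The exterior derivative `dθ` at `x`, evaluated on two tangent vectors. It is computed in the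
preferred chart at `x`, whose differential at `x` is the identity under the identification of
`TangentSpace I x` with the model space. -/
def OneForm.d (θ : OneForm I M) (x : M) (v w : TangentSpace I x) : ℝ :=
  (fderiv ℝ (θ.inChart x) (extChartAt I x x) v : E →L[ℝ] ℝ) w -
    (fderiv ℝ (θ.inChart x) (extChartAt I x x) w : E →L[ℝ] ℝ) v

/-- The annihilating space `ann(K)_x ⊆ T_x M`. -/
def ann (K : CoDistribution I M) (x : M) : Submodule ℝ (TangentSpace I x) where
  carrier := {v | ∀ θ ∈ K x, θ v = 0}
  add_mem' ha hb θ hθ := by rw [map_add, ha θ hθ, hb θ hθ, add_zero]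
  zero_mem' θ _ := map_zero θ
  smul_mem' c v hv θ hθ := by rw [map_smul, hv θ hθ, smul_zero]

/-- The one-forms `F i` are smooth on `U` and form a basis of `K x` for every `x ∈ U`. -/
structure IsLocalFrame {ι : Type*} (K : CoDistribution I M) (U : Set M) (F : ι → OneForm I M) :
    Prop where
  smooth : ∀ i, (F i).SmoothOn U
  linearIndependent : ∀ x ∈ U, LinearIndependent ℝ (fun i => F i x)
  span_eq : ∀ x ∈ U, Submodule.span ℝ (Set.range fun i => F i x) = K x

/-- `K` is a constant rank Pfaffian system: a smooth subbundle of constant rank of the cotangent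
bundle. -/
def IsPfaffian (K : CoDistribution I M) : Prop :=
  ∃ r : ℕ, ∀ x : M, ∃ U : Set M, IsOpen U ∧ x ∈ U ∧ ∃ F : Fin r → OneForm I M, IsLocalFrame K U F

/-- `K^∞`: the span at `x` of the differentials of the first integrals of `K` defined about `x`. -/
def firstIntegrals (K : CoDistribution I M) : CoDistribution I M := fun x =>
  Submodule.span ℝ {θ | ∃ (U : Set M) (F : M → ℝ), IsOpen U ∧ x ∈ U ∧
    ContMDiffOn I 𝓘(ℝ, ℝ) ∞ F U ∧
    (∀ y ∈ U, (mfderiv I 𝓘(ℝ, ℝ) F y : Cotangent I y) ∈ K y) ∧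
    θ = (mfderiv I 𝓘(ℝ, ℝ) F x : Cotangent I x)}

/-- The derived system `K'`: the span at `x` of the values of (local) smooth sections `θ` of `K`
with `dθ ≡ 0 mod K`, i.e. such that `dθ` vanishes on `ann(K)`. -/
def derived (K : CoDistribution I M) : CoDistribution I M := fun x =>
  Submodule.span ℝ {φ | ∃ (U : Set M) (θ : OneForm I M), IsOpen U ∧ x ∈ U ∧ θ.SmoothOn U ∧
    (∀ y ∈ U, θ y ∈ K y ∧ ∀ v ∈ ann K y, ∀ w ∈ ann K y, θ.d y v w = 0) ∧ φ = θ x}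

/-- `K` is decomposable with singular systems `Vhat` and `Vcheck`: about each point there is a
coframe `θ⁰, θ¹, θ², τ̂, ω̂, τ̌, ω̌` such that `K` is spanned by the `θ`'s, `K'` by the `θ⁰`'s,
`Vhat` by the `θ`'s, `τ̂`'s and `ω̂`'s, `Vcheck` by the `θ`'s, `τ̌`'s and `ω̌`'s, and modulo `K`
(i.e. on `ann(K)`) one has `dθ⁰ ≡ 0`, `dθ¹ ≡ A τ̂ ∧ ω̂` and `dθ² ≡ B τ̌ ∧ ω̌`. -/
structure IsDecomposable (n₁ p₁ n₂ p₂ : ℕ) (K Vhat Vcheck : CoDistribution I M) : Prop where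
  n₁_pos : 1 ≤ n₁
  p₁_pos : 1 ≤ p₁
  n₂_pos : 1 ≤ n₂
  p₂_pos : 1 ≤ p₂
  exists_coframe : ∀ x : M, ∃ U : Set M, IsOpen U ∧ x ∈ U ∧ ∃ (r₀ r₁ r₂ : ℕ)
    (θ₀ : Fin r₀ → OneForm I M) (θ₁ : Fin r₁ → OneForm I M) (θ₂ : Fin r₂ → OneForm I M)
    (τhat : Fin p₁ → OneForm I M) (ωhat : Fin n₁ → OneForm I M)
    (τcheck : Fin p₂ → OneForm I M) (ωcheck : Fin n₂ → OneForm I M)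
    (A : Fin r₁ → Fin p₁ → Fin n₁ → M → ℝ) (B : Fin r₂ → Fin p₂ → Fin n₂ → M → ℝ),
    IsLocalFrame (fun _ => ⊤) U
      (Sum.elim (Sum.elim θ₀ (Sum.elim θ₁ θ₂))
        (Sum.elim (Sum.elim τhat ωhat) (Sum.elim τcheck ωcheck))) ∧
    IsLocalFrame K U (Sum.elim θ₀ (Sum.elim θ₁ θ₂)) ∧
    IsLocalFrame (derived K) U θ₀ ∧
    IsLocalFrame Vhat U (Sum.elim (Sum.elim θ₀ (Sum.elim θ₁ θ₂)) (Sum.elim τhat ωhat)) ∧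
    IsLocalFrame Vcheck U (Sum.elim (Sum.elim θ₀ (Sum.elim θ₁ θ₂)) (Sum.elim τcheck ωcheck)) ∧
    ∀ y ∈ U, ∀ v ∈ ann K y, ∀ w ∈ ann K y,
      (∀ i, (θ₀ i).d y v w = 0) ∧
      (∀ i, (θ₁ i).d y v w = ∑ a, ∑ b,
        A i a b y * (τhat a y v * ωhat b y w - τhat a y w * ωhat b y v)) ∧
      (∀ i, (θ₂ i).d y v w = ∑ a, ∑ b,
        B i a b y * (τcheck a y v * ωcheck b y w - τcheck a y w * ωcheck b y v))

/-- `K` is Darboux integrable (with respect to its singular systems). -/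
structure IsDarbouxIntegrable (K Vhat Vcheck : CoDistribution I M) : Prop where
  firstIntegrals_eq : ∀ x, firstIntegrals K x = ⊥
  hat_sup : ∀ x, Vhat x ⊔ firstIntegrals Vcheck x = ⊤
  sup_check : ∀ x, firstIntegrals Vhat x ⊔ Vcheck x = ⊤

end Systems

section Maps

variable {E H M : Type*} [NormedAddCommGroup E] [NormedSpace ℝ E] [TopologicalSpace H]
  {I : ModelWithCorners ℝ E H} [TopologicalSpace M] [ChartedSpace H M]
  {E' H' N : Type*} [NormedAddCommGroup E'] [NormedSpace ℝ E'] [TopologicalSpace H']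
  {I' : ModelWithCorners ℝ E' H'} [TopologicalSpace N] [ChartedSpace H' N]

/-- The tangent space at the parameter `t` of the parametrized manifold `f`, as a subspace of
`T_{f t} M`. -/
def tangentImage (I' : ModelWithCorners ℝ E' H') (I : ModelWithCorners ℝ E H) (f : N → M) (t : N) :
    Submodule ℝ (TangentSpace I (f t)) :=
  LinearMap.range (mfderiv I' I f t).toLinearMap

variable (I') in
/-- An integral manifold of `K`: a smooth immersion `f` with `f^* K = 0`. -/
structure IsIntegralManifold (K : CoDistribution I M) (f : N → M) : Prop where
  smooth : ContMDiff I' I ∞ f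
  immersion : ∀ t, Function.Injective (mfderiv I' I f t)
  integral : ∀ t, tangentImage I' I f t ≤ ann K (f t)

variable (I') in
/-- The map `s : N → M` solves the local Cauchy problem for `K` about `x₀` with Cauchy data
`S ⊆ M`: it is an integral manifold of `K`, and there is an open neighbourhood `U` of `x₀` such
that the restriction `s : s⁻¹(U) → U` satisfies `S ∩ U ⊆ s(s⁻¹(U))`. -/
def SolvesLocalCauchy (K : CoDistribution I M) (S : Set M) (x₀ : M) (s : N → M) : Prop :=
  IsIntegralManifold I' K s ∧ ∃ U : Set M, IsOpen U ∧ x₀ ∈ U ∧ S ∩ U ⊆ s '' (s ⁻¹' U)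

variable (I') in
/-- Non-characteristic integral manifolds. The tangent spaces of an integral manifold lie in
`ann(K) = ann(Vhat) ⊕ ann(Vcheck)`, whose summands are the characteristic directions; a tangent
space of dimension `n₁ + n₂ - 1` is non-characteristic if it meets `ann(Vhat)` in dimension
`n₂ - 1` and `ann(Vcheck)` in dimension `n₁ - 1`. Equivalently, it is a hyperplane in
an `(n₁ + n₂)`-dimensional integral element `A ⊕ B` with `A ⊆ ann(Vhat)` of dimension `n₂` and
`B ⊆ ann(Vcheck)` of dimension `n₁`, and contains neither `A` nor `B`. For curves
(`n₁ = n₂ = 1`) this says that the velocity lies neither in `ann(Vhat)` nor in `ann(Vcheck)`. -/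
def IsNonCharacteristic (n₁ n₂ : ℕ) (Vhat Vcheck : CoDistribution I M) (f : N → M) : Prop :=
  ∀ t, Module.finrank ℝ ↥(tangentImage I' I f t ⊓ ann Vhat (f t)) + 1 = n₂ ∧
    Module.finrank ℝ ↥(tangentImage I' I f t ⊓ ann Vcheck (f t)) + 1 = n₁

/-- `I = J/q`, the reduction of `J` under the surjective submersion `q`: a covector belongs to `K`
iff its pullback under `q` belongs to `J`. (For `J` invariant under a group whose orbits are the
fibres of `q`, the condition does not depend on the chosen point of the fibre.) -/
def IsReduction (q : N → M) (J : CoDistribution I' N) (K : CoDistribution I M) : Prop :=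
  ∀ (y : N) (θ : Cotangent I (q y)), θ ∈ K (q y) ↔ θ.comp (mfderiv I' I q y) ∈ J y

/-- The sum `K₁ + K₂ = π₁^*(K₁) + π₂^*(K₂)` on the product. -/
def sumSystem (K₁ : CoDistribution I M) (K₂ : CoDistribution I' N) :
    CoDistribution (I.prod I') (M × N) := fun p =>
  Submodule.span ℝ
    ({φ | ∃ θ ∈ K₁ p.1, φ = θ.comp (mfderiv (I.prod I') I Prod.fst p)} ∪
      {φ | ∃ θ ∈ K₂ p.2, φ = θ.comp (mfderiv (I.prod I') I' Prod.snd p)})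

end Maps

section Actions

variable {EG HG G : Type*} [NormedAddCommGroup EG] [NormedSpace ℝ EG] [TopologicalSpace HG]
  (IG : ModelWithCorners ℝ EG HG) [TopologicalSpace G] [ChartedSpace HG G] [Group G]
  {E H X : Type*} [NormedAddCommGroup E] [NormedSpace ℝ E] [TopologicalSpace H]
  (I : ModelWithCorners ℝ E H) [TopologicalSpace X] [ChartedSpace H X]
  {E' H' Y : Type*} [NormedAddCommGroup E'] [NormedSpace ℝ E'] [TopologicalSpace H']
  (I' : ModelWithCorners ℝ E' H') [TopologicalSpace Y] [ChartedSpace H' Y]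

/-- A smooth local action of the Lie group `G` on the manifold `X`; `act g x` is meaningful only
for `(g, x)` in the open set `dom`. Global actions are the case `dom = univ`. -/
structure LocalAction (G X : Type*) [TopologicalSpace G] [ChartedSpace HG G] [Group G]
    [TopologicalSpace X] [ChartedSpace H X] where
  dom : Set (G × X)
  act : G → X → X
  isOpen_dom : IsOpen dom
  smooth : ContMDiffOn (IG.prod I) I ∞ (fun p : G × X => act p.1 p.2) dom
  one_mem : ∀ x, ((1 : G), x) ∈ dom
  one_act : ∀ x, act 1 x = x
  inv_mem : ∀ g x, (g, x) ∈ dom → (g⁻¹, act g x) ∈ dom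
  mul_act : ∀ g h x, (h, x) ∈ dom → (g, act h x) ∈ dom → (g * h, x) ∈ dom →
    act (g * h) x = act g (act h x)

variable {IG I I'}

namespace LocalAction

/-- Points are equivalent if they lie on the same orbit. -/
def OrbitRel (a : LocalAction IG I G X) : X → X → Prop :=
  Relation.EqvGen fun x y => ∃ g : G, (g, x) ∈ a.dom ∧ a.act g x = y

def IsFree (a : LocalAction IG I G X) : Prop :=
  ∀ g x, (g, x) ∈ a.dom → a.act g x = x → g = 1

/-- `G` is a symmetry group of `K`: `g^* K = K` for all `g`. -/
def IsSymmetry (a : LocalAction IG I G X) (K : CoDistribution I X) : Prop :=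
  ∀ g x, (g, x) ∈ a.dom → ∀ θ : Cotangent I (a.act g x),
    θ ∈ K (a.act g x) ↔ θ.comp (mfderiv I I (a.act g) x) ∈ K x

/-- The smooth surjective submersion `q : X → Y` is the quotient map of the action, i.e. its fibres
are the orbits; in particular the action is regular and `Y = X/G`. -/
structure IsQuotientMap (a : LocalAction IG I G X) (I' : ModelWithCorners ℝ E' H') (q : X → Y) :
    Prop where
  smooth : ContMDiff I I' ∞ q
  surjective : Function.Surjective q
  submersion : ∀ x, Function.Surjective (mfderiv I I' q x)
  fibre_iff : ∀ x y, q x = q y ↔ a.OrbitRel x y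

/-- The diagonal action of `G` on a product. -/
def diag (a : LocalAction IG I G X) (b : LocalAction IG I' G Y) :
    LocalAction IG (I.prod I') G (X × Y) where
  dom := {p | (p.1, p.2.1) ∈ a.dom ∧ (p.1, p.2.2) ∈ b.dom}
  act g p := (a.act g p.1, b.act g p.2)
  isOpen_dom := (a.isOpen_dom.preimage (by fun_prop)).inter (b.isOpen_dom.preimage (by fun_prop))
  smooth := by
    refine ContMDiffOn.prodMk ?_ ?_
    · refine a.smooth.comp (f := fun p : G × X × Y => (p.1, p.2.1)) ?_ (fun p hp => hp.1)
      exact (contMDiff_fst.prodMk (contMDiff_fst.comp contMDiff_snd)).contMDiffOn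
    · refine b.smooth.comp (f := fun p : G × X × Y => (p.1, p.2.2)) ?_ (fun p hp => hp.2)
      exact (contMDiff_fst.prodMk (contMDiff_snd.comp contMDiff_snd)).contMDiffOn
  one_mem x := ⟨a.one_mem x.1, b.one_mem x.2⟩
  one_act x := by simp [a.one_act, b.one_act]
  inv_mem g x h := ⟨a.inv_mem g x.1 h.1, b.inv_mem g x.2 h.2⟩
  mul_act g h x h₁ h₂ h₃ :=
    Prod.ext (a.mul_act g h x.1 h₁.1 h₂.1 h₃.1) (b.mul_act g h x.2 h₁.2 h₂.2 h₃.2)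

end LocalAction

/-- A map `q` (the quotient map of an action) is transverse to `K`: `ker(q_*) ∩ ann(K) = 0`. -/
def IsTransverse (I' : ModelWithCorners ℝ E' H') (q : X → Y) (K : CoDistribution I X) : Prop :=
  ∀ x, LinearMap.ker (mfderiv I I' q x).toLinearMap ⊓ ann K x = ⊥

end Actions

section Representation

variable {EG G E M E₁ M₁ E₂ M₂ Q₁ Q₂ : Type*} (F₁ F₂ : Type*)
  [NormedAddCommGroup EG] [NormedSpace ℝ EG] [TopologicalSpace G] [ChartedSpace EG G] [Group G]
  [NormedAddCommGroup E] [NormedSpace ℝ E] [TopologicalSpace M] [ChartedSpace E M]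
  [NormedAddCommGroup E₁] [NormedSpace ℝ E₁] [TopologicalSpace M₁] [ChartedSpace E₁ M₁]
  [NormedAddCommGroup E₂] [NormedSpace ℝ E₂] [TopologicalSpace M₂] [ChartedSpace E₂ M₂]
  [NormedAddCommGroup F₁] [NormedSpace ℝ F₁] [TopologicalSpace Q₁] [ChartedSpace F₁ Q₁]
  [NormedAddCommGroup F₂] [NormedSpace ℝ F₂] [TopologicalSpace Q₂] [ChartedSpace F₂ Q₂]

/-- `((K₁ + K₂)/G_diag, (M₁ × M₂)/G_diag)` is a canonical quotient representation of the system `K`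
on `M` with singular systems `Vhat`, `Vcheck`. Here `q₁ : M₁ → M₁/G`, `q₂ : M₂ → M₂/G` and
`q : M₁ × M₂ → M = (M₁ × M₂)/G_diag` are the quotient maps. -/
structure IsQuotientRepresentation
    (K Vhat Vcheck : CoDistribution 𝓘(ℝ, E) M)
    (a₁ : LocalAction 𝓘(ℝ, EG) 𝓘(ℝ, E₁) G M₁) (a₂ : LocalAction 𝓘(ℝ, EG) 𝓘(ℝ, E₂) G M₂)
    (K₁ : CoDistribution 𝓘(ℝ, E₁) M₁) (K₂ : CoDistribution 𝓘(ℝ, E₂) M₂)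
    (q₁ : M₁ → Q₁) (q₂ : M₂ → Q₂) (q : M₁ × M₂ → M) : Prop where
  pfaffian₁ : IsPfaffian K₁
  pfaffian₂ : IsPfaffian K₂
  firstIntegrals₁ : ∀ x, firstIntegrals K₁ x = ⊥
  firstIntegrals₂ : ∀ x, firstIntegrals K₂ x = ⊥
  free₁ : a₁.IsFree
  free₂ : a₂.IsFree
  regular₁ : a₁.IsQuotientMap 𝓘(ℝ, F₁) q₁
  regular₂ : a₂.IsQuotientMap 𝓘(ℝ, F₂) q₂
  symmetry₁ : a₁.IsSymmetry K₁
  symmetry₂ : a₂.IsSymmetry K₂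
  transverse₁ : IsTransverse 𝓘(ℝ, F₁) q₁ K₁
  transverse₂ : IsTransverse 𝓘(ℝ, F₂) q₂ K₂
  regular_diag : (a₁.diag a₂).IsQuotientMap 𝓘(ℝ, E) q
  transverse_diag : IsTransverse 𝓘(ℝ, E) q (sumSystem (derived K₁) (derived K₂))
  reduction : IsReduction q (sumSystem K₁ K₂) K
  reduction_hat : IsReduction q
    (sumSystem K₁ (fun _ => ⊤ : CoDistribution 𝓘(ℝ, E₂) M₂)) Vhat
  reduction_check : IsReduction q
    (sumSystem (fun _ => ⊤ : CoDistribution 𝓘(ℝ, E₁) M₁) K₂) Vcheck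

end Representation

section Lift

variable {E H M : Type*} [NormedAddCommGroup E] [NormedSpace ℝ E] [TopologicalSpace H]
  {I : ModelWithCorners ℝ E H} [TopologicalSpace M] [ChartedSpace H M]
  {E' H' N : Type*} [NormedAddCommGroup E'] [NormedSpace ℝ E'] [TopologicalSpace H']
  {I' : ModelWithCorners ℝ E' H'} [TopologicalSpace N] [ChartedSpace H' N]
  {ES HS S : Type*} [NormedAddCommGroup ES] [NormedSpace ℝ ES] [TopologicalSpace HS]
  {IS : ModelWithCorners ℝ ES HS} [TopologicalSpace S] [ChartedSpace HS S]
  {EL HL L : Type*} [NormedAddCommGroup EL] [NormedSpace ℝ EL] [TopologicalSpace HL]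
  {IL : ModelWithCorners ℝ EL HL} [TopologicalSpace L] [ChartedSpace HL L]

/-- `ι : L → N` is a lift through `q : N → M` of the submanifold `γ : S → M`: it is an integral
manifold of the restriction of `J` to `q⁻¹(S)` whose tangent spaces are the full spaces
`ann(J) ∩ T(q⁻¹(S))`, where `T(q⁻¹(S)) = (q_*)⁻¹(TS)`, i.e. a maximal integral manifold of
`J|_{q⁻¹(S)}` or an open piece of one. No condition on the dimension of `L` is imposed. -/
structure IsLift (IS : ModelWithCorners ℝ ES HS) (IL : ModelWithCorners ℝ EL HL)
    (I : ModelWithCorners ℝ E H) (J : CoDistribution I' N) (q : N → M) (γ : S → M) (ι : L → N) :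
    Prop where
  integral : IsIntegralManifold IL J ι
  mem : ∀ l, q (ι l) ∈ Set.range γ
  full : ∀ l, ∀ v ∈ ann J (ι l),
    (∃ s, ∃ w : TangentSpace IS s, γ s = q (ι l) ∧
      (mfderiv IS I γ s w : E) = (mfderiv I' I q (ι l) v : E)) →
    v ∈ tangentImage IL I' ι l

end Lift

end DarbouxCauchy

end

/-! Everything follows from one isomorphism. At `y = (y₁, y₂)` the reduction makes `q_*` map `ann(K₁
+ K₂) = ann K₁ ⊕ ann K₂` onto `ann K` (`mem_ann_of_isReduction`). Since `Kᵢ' ⊆ Kᵢ`, transversality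
to `K₁' + K₂'` makes `q_*` injective there (`eq_zero_of_mem_ann_sumSystem_of_isTransverse`). Under
this isomorphism `ann Vhat` is the summand `ann K₁ ⊕ 0` and `ann Vcheck` is `0 ⊕ ann K₂`.

The tangent space of the lift `L` corresponds to `TS`, and the kernel of `π₁` on it to `TS ∩ ann
Vcheck`, of dimension `n₁ - 1`. So `π₁` has constant rank `(n₁ + n₂ - 1) - (n₁ - 1) = n₂` on `L`,
and likewise `π₂` has rank `n₁` (`finrank_map_lift_add_finrank`). The constant rank theorem turns
the local images into embedded integral manifolds parametrized by whole Euclidean spaces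
(`exists_embedded_integralManifold_of_finrank_tangentImage_eq`).

Tangent vectors of a product of two such pieces lie in `ann K₁ ⊕ ann K₂`, so `q` restricted to it is
an immersion tangent to `ann K` (`IsIntegralManifold.comp_prodMap`). Finally `q ∘ ι` factors through
a smooth submersion `σ : L → S`, which is open; a neighbourhood of the base point in `S` thus
consists of points `q (π₁ l', π₂ l')` with `l'` in both pieces, all of them values of `s`. -/

namespace DarbouxCauchy

/-! ### Constant rank maps between vector spaces -/

/-- Local form of maps of constant rank: near each point, the image of a map of constant rank `r`
is parametrized by `ℝ^r`, and the parametrization `F ∘ c` has a smooth left inverse `g`. -/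
theorem exists_section_of_finrank_range_fderiv_eq
    {E E' : Type*} [NormedAddCommGroup E] [NormedSpace ℝ E] [FiniteDimensional ℝ E]
    [NormedAddCommGroup E'] [NormedSpace ℝ E'] [FiniteDimensional ℝ E']
    {F : E → E'} {U : Set E} {x : E} {r : ℕ} (hU : IsOpen U) (hx : x ∈ U)
    (hF : ContDiffOn ℝ ∞ F U)
    (hr : ∀ y ∈ U, Module.finrank ℝ (LinearMap.range (fderiv ℝ F y).toLinearMap) = r) :
    ∃ (A : Set E) (c : EuclideanSpace ℝ (Fin r) → E) (V : Set E')
      (g : E' → EuclideanSpace ℝ (Fin r)),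
      IsOpen A ∧ x ∈ A ∧ A ⊆ U ∧ ContDiff ℝ ∞ c ∧ (∀ u, c u ∈ A) ∧
      IsOpen V ∧ ContDiffOn ℝ ∞ g V ∧ (∀ u, F (c u) ∈ V ∧ g (F (c u)) = u) ∧
      F '' A ⊆ Set.range (F ∘ c) := by
  have hFat : ∀ y ∈ U, ContDiffAt ℝ ∞ F y := fun y hy => hF.contDiffAt (hU.mem_nhds hy)
  have hFd : ∀ y ∈ U, HasFDerivAt F (fderiv ℝ F y) y := fun y hy =>
    ((hFat y hy).differentiableAt (by simp)).hasFDerivAt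
  -- `P` extends an isomorphism of the `r`-dimensional range of the differential at `x` with `ℝ^r`,
  -- so that `P ∘ F` is a submersion at `x`.
  obtain ⟨P, hP⟩ : ∃ P : E' →L[ℝ] EuclideanSpace ℝ (Fin r),
      Function.Surjective (P.comp (fderiv ℝ F x)) := by
    let e : LinearMap.range (fderiv ℝ F x).toLinearMap ≃ₗ[ℝ] EuclideanSpace ℝ (Fin r) :=
      LinearEquiv.ofFinrankEq _ _ (by rw [hr x hx, finrank_euclideanSpace_fin])
    obtain ⟨P, hP⟩ := LinearMap.exists_extend e.toLinearMap
    refine ⟨LinearMap.toContinuousLinearMap P, fun u => ?_⟩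
    obtain ⟨v, hv⟩ := (e.symm u).2
    refine ⟨v, ?_⟩
    have := LinearMap.congr_fun hP (e.symm u)
    simp only [LinearMap.comp_apply, Submodule.subtype_apply, ← hv, LinearEquiv.coe_coe,
      e.apply_symm_apply] at this
    exact this
  let D : E →L[ℝ] EuclideanSpace ℝ (Fin r) := P.comp (fderiv ℝ F x)
  have hDsurj : Function.Surjective D := hP
  let W := LinearMap.ker D.toLinearMap
  obtain ⟨Q, hQ⟩ : ∃ Q : E →L[ℝ] W, ∀ w : W, Q w = w := by
    obtain ⟨Q, hQ⟩ := LinearMap.exists_extend (LinearMap.id : W →ₗ[ℝ] W)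
    exact ⟨LinearMap.toContinuousLinearMap Q, fun w => LinearMap.congr_fun hQ w⟩
  have hbij : Function.Bijective (D.prod Q) := by
    constructor
    · rw [injective_iff_map_eq_zero]
      intro v hv
      have h1 : D v = 0 := congrArg Prod.fst hv
      have h2 : Q v = 0 := congrArg Prod.snd hv
      have h3 := hQ ⟨v, h1⟩
      rw [h2] at h3
      exact (congrArg Subtype.val h3).symm
    · rintro ⟨u, w⟩
      obtain ⟨v, rfl⟩ := hDsurj u
      have hk : ∀ w : W, D w = 0 := fun w => w.2
      refine ⟨v - Q v + w, Prod.ext ?_ ?_⟩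
      · simp [hk]
      · simp [hQ]
  let Φ' : E ≃L[ℝ] EuclideanSpace ℝ (Fin r) × W :=
    (LinearEquiv.ofBijective (D.prod Q).toLinearMap hbij).toContinuousLinearEquiv
  -- Straightening coordinates: `Q` projects onto the kernel `W` of the differential of `P ∘ F` at
  -- `x`, so the inverse function theorem applies to `Φ`.
  let Φ : E → EuclideanSpace ℝ (Fin r) × W := fun y => (P (F y), Q y)
  have hΦat : ∀ y ∈ U, ContDiffAt ℝ ∞ Φ y := fun y hy =>
    (P.contDiff.contDiffAt.comp y (hFat y hy)).prodMk Q.contDiff.contDiffAt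
  have hΦd : ∀ y ∈ U, HasFDerivAt Φ ((P.comp (fderiv ℝ F y)).prod Q) y := fun y hy =>
    (P.hasFDerivAt.comp y (hFd y hy)).prodMk Q.hasFDerivAt
  have hΦx : HasFDerivAt Φ (Φ' : E →L[ℝ] EuclideanSpace ℝ (Fin r) × W) x := by
    exact hΦd x hx
  let e := (hΦat x hx).toOpenPartialHomeomorph Φ hΦx (by simp)
  have hex : x ∈ e.source := (hΦat x hx).mem_toOpenPartialHomeomorph_source hΦx (by simp)
  -- Smoothness of the inverse at each nearby point, not only at `Φ x`, needs an invertible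
  -- differential there.
  have hinv : ∀ᶠ y in 𝓝 x, y ∈ U ∧ fderiv ℝ Φ y ∈
      Set.range ((↑) : (E ≃L[ℝ] EuclideanSpace ℝ (Fin r) × W) → _) := by
    refine Filter.Eventually.and (hU.mem_nhds hx) ?_
    have hc : ContinuousAt (fderiv ℝ Φ) x :=
      ((hΦat x hx).fderiv_right (m := 0) (by simp)).continuousAt
    exact hc.eventually_mem (ContinuousLinearEquiv.isOpen.mem_nhds ⟨Φ', hΦx.fderiv.symm⟩)
  obtain ⟨ε, hε, hbox⟩ : ∃ ε > 0, ∀ z ∈ Metric.ball (Φ x) ε, z ∈ e.target ∧ e.symm z ∈ U ∧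
      fderiv ℝ Φ (e.symm z) ∈
        Set.range ((↑) : (E ≃L[ℝ] EuclideanSpace ℝ (Fin r) × W) → _) := by
    have h1 : ∀ᶠ z in 𝓝 (Φ x), z ∈ e.target :=
      e.open_target.mem_nhds (e.map_source hex)
    have h2 := (e.tendsto_symm hex).eventually hinv
    exact Metric.eventually_nhds_iff_ball.1 (h1.and h2)
  have hψat : ∀ z ∈ Metric.ball (Φ x) ε, ContDiffAt ℝ ∞ e.symm z := by
    intro z hz
    obtain ⟨h1, h2, L, hL⟩ := hbox z hz
    refine e.contDiffAt_symm (f₀' := L) h1 ?_ (hΦat _ h2)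
    rw [hL]
    exact ((hΦat _ h2).differentiableAt (by simp)).hasFDerivAt
  have hPh : ∀ z ∈ Metric.ball (Φ x) ε, P (F (e.symm z)) = z.1 := fun z hz =>
    congrArg Prod.fst (e.right_inv (hbox z hz).1)
  -- Here the rank near `x` matters: `P` maps the `r`-dimensional range of the differential of `F`
  -- onto `ℝ^r`, hence injectively, and it kills the image of `(0, w)` because `P ∘ F` is the first
  -- coordinate.
  have hker : ∀ z ∈ Metric.ball (Φ x) ε, ∀ w : W,
      fderiv ℝ F (e.symm z) (fderiv ℝ e.symm z (0, w)) = 0 := by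
    intro z hz w
    have hz' := (hbox z hz).2.1
    have hd : HasFDerivAt (fun z => P (F (e.symm z)))
        (P.comp ((fderiv ℝ F (e.symm z)).comp (fderiv ℝ e.symm z))) z :=
      P.hasFDerivAt.comp z ((hFd _ hz').comp z
        ((hψat z hz).differentiableAt (by simp)).hasFDerivAt)
    have hd' : HasFDerivAt (fun z : EuclideanSpace ℝ (Fin r) × W => P (F (e.symm z)))
        (ContinuousLinearMap.fst ℝ _ _) z := by
      refine hasFDerivAt_fst.congr_of_eventuallyEq ?_
      filter_upwards [Metric.isOpen_ball.mem_nhds hz] with z' hz' using hPh z' hz'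
    have heq := fun v => DFunLike.congr_fun (hd.unique hd') v
    let R := LinearMap.range (fderiv ℝ F (e.symm z)).toLinearMap
    let PR : R →ₗ[ℝ] EuclideanSpace ℝ (Fin r) := P.toLinearMap.comp R.subtype
    have hPR : Function.Surjective PR := fun u =>
      ⟨⟨_, fderiv ℝ e.symm z (u, 0), rfl⟩, heq (u, 0)⟩
    have hinj : Function.Injective PR :=
      (LinearMap.injective_iff_surjective_of_finrank_eq_finrank
        (by rw [hr _ hz', finrank_euclideanSpace_fin])).2 hPR
    have := (injective_iff_map_eq_zero PR).1 hinj
      ⟨_, fderiv ℝ e.symm z (0, w), rfl⟩ (heq (0, w))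
    exact congrArg Subtype.val this
  have hball : Metric.ball (Φ x) ε = Metric.ball (Φ x).1 ε ×ˢ Metric.ball (Φ x).2 ε :=
    (ball_prod_same _ _ _).symm
  have hconst : ∀ u ∈ Metric.ball (Φ x).1 ε, ∀ w ∈ Metric.ball (Φ x).2 ε,
      F (e.symm (u, w)) = F (e.symm (u, (Φ x).2)) := by
    intro u hu w hw
    have hmem : ∀ w ∈ Metric.ball (Φ x).2 ε, (u, w) ∈ Metric.ball (Φ x) ε := fun w hw => by
      rw [hball]; exact ⟨hu, hw⟩
    have hder : ∀ w ∈ Metric.ball (Φ x).2 ε, HasFDerivAt (fun w => F (e.symm (u, w)))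
        (0 : W →L[ℝ] E') w := by
      intro w hw
      have h := (hFd _ (hbox _ (hmem w hw)).2.1).comp w
        (((hψat _ (hmem w hw)).differentiableAt (by simp)).hasFDerivAt.comp w
          (hasFDerivAt_prodMk_right u w))
      exact h.congr_fderiv (ContinuousLinearMap.ext fun v => hker _ (hmem w hw) v)
    exact Metric.isOpen_ball.is_const_of_fderiv_eq_zero (𝕜 := ℝ)
      (convex_ball _ _).isPreconnected
      (fun w hw => (hder w hw).differentiableAt.differentiableWithinAt)
      (fun w hw => (hder w hw).fderiv) hw (Metric.mem_ball_self hε)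
  -- A diffeomorphism of all of `ℝ^r` onto the ball, making the parametrization global.
  let b := OpenPartialHomeomorph.univBall (E := EuclideanSpace ℝ (Fin r)) (Φ x).1 ε
  have hbs : b.source = Set.univ := OpenPartialHomeomorph.univBall_source _ _
  have hbt : b.target = Metric.ball (Φ x).1 ε := OpenPartialHomeomorph.univBall_target _ hε
  have hbm : ∀ u, b u ∈ Metric.ball (Φ x).1 ε := fun u => hbt ▸ b.map_source (hbs ▸ trivial)
  have hbox' : ∀ u, (b u, (Φ x).2) ∈ Metric.ball (Φ x) ε := fun u => by
    rw [hball]; exact ⟨hbm u, Metric.mem_ball_self hε⟩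
  have hAU : e.source ∩ e ⁻¹' Metric.ball (Φ x) ε ⊆ U := by
    rintro y ⟨hy1, hy2⟩
    have := (hbox _ hy2).2.1
    rwa [e.left_inv hy1] at this
  -- `F` does not depend on the `W` coordinate, so the slice through `(Φ x).2` already covers the
  -- image; `P` recovers the remaining coordinate.
  refine ⟨e.source ∩ e ⁻¹' Metric.ball (Φ x) ε, fun u => e.symm (b u, (Φ x).2),
    P ⁻¹' Metric.ball (Φ x).1 ε, fun y => b.symm (P y),
    e.isOpen_inter_preimage Metric.isOpen_ball, ⟨hex, Metric.mem_ball_self hε⟩, hAU, ?_, ?_,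
    Metric.isOpen_ball.preimage P.continuous, ?_, ?_, ?_⟩
  · rw [contDiff_iff_contDiffAt]
    intro u
    exact (hψat _ (hbox' u)).comp u
      (OpenPartialHomeomorph.contDiff_univBall.contDiffAt.prodMk contDiffAt_const)
  · intro u
    refine ⟨e.map_target (hbox _ (hbox' u)).1, ?_⟩
    rw [Set.mem_preimage, e.right_inv (hbox _ (hbox' u)).1]
    exact hbox' u
  · exact OpenPartialHomeomorph.contDiffOn_univBall_symm.comp P.contDiff.contDiffOn
      (fun y hy => hy)
  · intro u
    have := hPh _ (hbox' u)
    refine ⟨by rw [Set.mem_preimage, this]; exact hbm u, ?_⟩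
    simp only [this]
    exact b.left_inv (hbs ▸ trivial)
  · rintro _ ⟨y, ⟨hy1, hy2⟩, rfl⟩
    have hy3 : e y ∈ Metric.ball (Φ x).1 ε ×ˢ Metric.ball (Φ x).2 ε := hball ▸ hy2
    refine ⟨b.symm (e y).1, ?_⟩
    have h1 : b (b.symm (e y).1) = (e y).1 := b.right_inv (hbt ▸ hy3.1)
    have h2 := hconst _ hy3.1 _ hy3.2
    simp only [Function.comp_apply, h1]
    rw [← h2, Prod.mk.eta, e.left_inv hy1]

end DarbouxCauchy

/-! ### Constant rank maps between manifolds -/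

namespace DarbouxCauchy

section ConstantRank

variable {E L E' N : Type*}
  [NormedAddCommGroup E] [NormedSpace ℝ E] [FiniteDimensional ℝ E]
  [TopologicalSpace L] [ChartedSpace E L] [IsManifold 𝓘(ℝ, E) ∞ L]
  [NormedAddCommGroup E'] [NormedSpace ℝ E'] [FiniteDimensional ℝ E']
  [TopologicalSpace N] [ChartedSpace E' N] [IsManifold 𝓘(ℝ, E') ∞ N]

/-- The constant rank theorem for the image of a map of manifolds. -/
theorem exists_section_of_finrank_tangentImage_eq {f : L → N} {r : ℕ}
    (hf : ContMDiff 𝓘(ℝ, E) 𝓘(ℝ, E') ∞ f)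
    (hr : ∀ l, Module.finrank ℝ (tangentImage 𝓘(ℝ, E) 𝓘(ℝ, E') f l) = r) (l : L) :
    ∃ (A : Set L) (c : EuclideanSpace ℝ (Fin r) → L) (V : Set N)
      (g : N → EuclideanSpace ℝ (Fin r)),
      IsOpen A ∧ l ∈ A ∧ ContMDiff (𝓡 r) 𝓘(ℝ, E) ∞ c ∧ (∀ u, c u ∈ A) ∧
      IsOpen V ∧ ContMDiffOn 𝓘(ℝ, E') (𝓡 r) ∞ g V ∧ (∀ u, f (c u) ∈ V ∧ g (f (c u)) = u) ∧
      f '' A = Set.range (f ∘ c) := by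
  let e := chartAt E l
  let e' := chartAt E' (f l)
  have he : ContMDiffOn 𝓘(ℝ, E) 𝓘(ℝ, E) ∞ e e.source := contMDiffOn_chart
  have he' : ContMDiffOn 𝓘(ℝ, E') 𝓘(ℝ, E') ∞ e' e'.source := contMDiffOn_chart
  have hes : ContMDiffOn 𝓘(ℝ, E) 𝓘(ℝ, E) ∞ e.symm e.target := contMDiffOn_chart_symm
  have hel : l ∈ e.source := mem_chart_source E l
  let U := e.target ∩ e.symm ⁻¹' (f ⁻¹' e'.source)
  have hU : IsOpen U :=
    e.isOpen_inter_preimage_symm (e'.open_source.preimage hf.continuous)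
  have hlU : e l ∈ U := ⟨e.map_source hel, by
    simp only [Set.mem_preimage, e.left_inv hel]
    exact mem_chart_source E' (f l)⟩
  have hF : ContMDiffOn 𝓘(ℝ, E) 𝓘(ℝ, E') ∞ (fun y => e' (f (e.symm y))) U :=
    he'.comp (hf.comp_contMDiffOn (hes.mono Set.inter_subset_left)) fun y hy => hy.2
  have hFr : ∀ y ∈ U, Module.finrank ℝ
      (LinearMap.range (fderiv ℝ (fun y => e' (f (e.symm y))) y).toLinearMap) = r := by
    intro y hy
    have hd := mdifferentiable_chart (I := 𝓘(ℝ, E)) l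
    have hd' := mdifferentiable_chart (I := 𝓘(ℝ, E')) (f l)
    have h1 : MDifferentiableAt 𝓘(ℝ, E) 𝓘(ℝ, E) e.symm y := hd.mdifferentiableAt_symm hy.1
    have h2 : MDifferentiableAt 𝓘(ℝ, E) 𝓘(ℝ, E') f (e.symm y) :=
      hf.mdifferentiable (by simp) _
    have h3 : MDifferentiableAt 𝓘(ℝ, E') 𝓘(ℝ, E') e' (f (e.symm y)) :=
      hd'.mdifferentiableAt hy.2
    let D₁ : E →L[ℝ] E := mfderiv 𝓘(ℝ, E) 𝓘(ℝ, E) e.symm y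
    let D₂ : E →L[ℝ] E' := mfderiv 𝓘(ℝ, E) 𝓘(ℝ, E') f (e.symm y)
    let D₃ : E' →L[ℝ] E' := mfderiv 𝓘(ℝ, E') 𝓘(ℝ, E') e' (f (e.symm y))
    have hcomp : HasFDerivAt (fun y => e' (f (e.symm y))) (D₃.comp (D₂.comp D₁)) y :=
      hasMFDerivAt_iff_hasFDerivAt.1
        (h3.hasMFDerivAt.comp y (h2.hasMFDerivAt.comp y h1.hasMFDerivAt))
    -- Charts preserve the rank: the inner differential is onto and the outer one is injective.
    have hsurj : LinearMap.range D₁.toLinearMap = ⊤ :=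
      LinearMap.range_eq_top.2 (hd.symm.mfderiv_surjective (x := y) hy.1)
    have hinj : Function.Injective D₃ := hd'.mfderiv_injective hy.2
    rw [hcomp.fderiv, ContinuousLinearMap.toLinearMap_comp, ContinuousLinearMap.toLinearMap_comp,
      LinearMap.range_comp, LinearMap.range_comp, hsurj, Submodule.map_top]
    exact (LinearEquiv.finrank_eq (Submodule.equivMapOfInjective
      D₃.toLinearMap hinj (LinearMap.range D₂.toLinearMap))).symm.trans (hr (e.symm y))
  obtain ⟨A, c, V, g, hA, hlA, hAU, hc, hcA, hV, hg, hgF, him⟩ :=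
    exists_section_of_finrank_range_fderiv_eq hU hlU hF.contDiffOn hFr
  have hcU : ∀ u, c u ∈ U := fun u => hAU (hcA u)
  refine ⟨e.source ∩ e ⁻¹' A, e.symm ∘ c, e'.source ∩ e' ⁻¹' V, g ∘ e',
    e.isOpen_inter_preimage hA, ⟨hel, hlA⟩, ?_, ?_, e'.isOpen_inter_preimage hV, ?_, ?_, ?_⟩
  · exact hes.comp_contMDiff hc.contMDiff fun u => (hcU u).1
  · exact fun u => ⟨e.map_target (hcU u).1, by
      simp only [Set.mem_preimage, Function.comp_apply, e.right_inv (hcU u).1, hcA u]⟩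
  · exact hg.contMDiffOn.comp (he'.mono Set.inter_subset_left) fun y hy => hy.2
  · exact fun u => ⟨⟨(hcU u).2, (hgF u).1⟩, (hgF u).2⟩
  · refine Set.Subset.antisymm ?_ ?_
    · rintro _ ⟨y, ⟨hy1, hy2⟩, rfl⟩
      obtain ⟨u, hu⟩ := him ⟨e y, hy2, rfl⟩
      have hy3 := (hAU hy2).2
      simp only [Set.mem_preimage, e.left_inv hy1] at hy3
      refine ⟨u, e'.injOn (hcU u).2 hy3 ?_⟩
      simpa only [Function.comp_apply, e.left_inv hy1] using hu
    · rintro _ ⟨u, rfl⟩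
      exact ⟨_, ⟨e.map_target (hcU u).1, by
        simp only [Set.mem_preimage, e.right_inv (hcU u).1, hcA u]⟩, rfl⟩

end ConstantRank

/-! ### Embeddings, immersions and submersions -/

/-- A map with a left inverse that is continuous on an open neighbourhood of the range is an
embedding. -/
theorem isEmbedding_of_leftInverse_of_continuousOn {X Y : Type*} [TopologicalSpace X]
    [TopologicalSpace Y] {h : X → Y} {V : Set Y} {g : Y → X} (hh : Continuous h)
    (hg : ContinuousOn g V) (hV : ∀ x, h x ∈ V) (hgh : ∀ x, g (h x) = x) :
    Topology.IsEmbedding h :=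
  Topology.IsEmbedding.subtypeVal.comp
    (Function.LeftInverse.isEmbedding (f := V.domRestrict g) (g := V.codRestrict h hV)
      hgh hg.domRestrict (hh.codRestrict hV))

section Manifolds

variable {E L E' N : Type*}
  [NormedAddCommGroup E] [NormedSpace ℝ E] [TopologicalSpace L] [ChartedSpace E L]
  [NormedAddCommGroup E'] [NormedSpace ℝ E'] [TopologicalSpace N] [ChartedSpace E' N]

/-- A map with a smooth left inverse on an open neighbourhood of its range is an immersion. -/
theorem mfderiv_injective_of_leftInverse {h : L → N} {V : Set N} {g : N → L}
    (hh : ContMDiff 𝓘(ℝ, E) 𝓘(ℝ, E') ∞ h) (hV : IsOpen V)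
    (hg : ContMDiffOn 𝓘(ℝ, E') 𝓘(ℝ, E) ∞ g V) (hhV : ∀ x, h x ∈ V)
    (hgh : ∀ x, g (h x) = x) (x : L) :
    Function.Injective (mfderiv 𝓘(ℝ, E) 𝓘(ℝ, E') h x) := by
  have h1 := (hh.mdifferentiable (by simp) x).hasMFDerivAt
  have h2 := ((hg.contMDiffAt (hV.mem_nhds (hhV x))).mdifferentiableAt (by simp)).hasMFDerivAt
  have h3 := h2.comp x h1
  have h4 : HasMFDerivAt 𝓘(ℝ, E) 𝓘(ℝ, E) (g ∘ h) x (ContinuousLinearMap.id ℝ _) := by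
    rw [show g ∘ h = id from funext hgh]
    exact hasMFDerivAt_id x
  have h5 := hasMFDerivAt_unique h3 h4
  exact Function.LeftInverse.injective (g := mfderiv 𝓘(ℝ, E') 𝓘(ℝ, E) g (h x))
    fun v => DFunLike.congr_fun h5 v

/-- A submersion is open. -/
theorem map_nhds_eq_of_mfderiv_surjective [CompleteSpace E] [CompleteSpace E']
    [IsManifold 𝓘(ℝ, E) ∞ L] [IsManifold 𝓘(ℝ, E') ∞ N] {f : L → N} {l : L}
    (hf : ContMDiff 𝓘(ℝ, E) 𝓘(ℝ, E') ∞ f)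
    (hs : Function.Surjective (mfderiv 𝓘(ℝ, E) 𝓘(ℝ, E') f l)) :
    Filter.map f (𝓝 l) = 𝓝 (f l) := by
  let e := chartAt E l
  let e' := chartAt E' (f l)
  have hel : l ∈ e.source := mem_chart_source E l
  have hel' : f l ∈ e'.source := mem_chart_source E' (f l)
  have h1 : ContMDiffAt 𝓘(ℝ, E) 𝓘(ℝ, E) ∞ e.symm (e l) :=
    contMDiffOn_chart_symm.contMDiffAt (e.open_target.mem_nhds (e.map_source hel))
  have h3 : ContMDiffAt 𝓘(ℝ, E') 𝓘(ℝ, E') ∞ e' (f l) :=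
    contMDiffOn_chart.contMDiffAt (e'.open_source.mem_nhds hel')
  have hll : e.symm (e l) = l := e.left_inv hel
  have h2 : ContMDiffAt 𝓘(ℝ, E) 𝓘(ℝ, E') ∞ (f ∘ e.symm) (e l) :=
    (hf _).comp (e l) h1
  have hF : ContMDiffAt 𝓘(ℝ, E) 𝓘(ℝ, E') ∞ (e' ∘ f ∘ e.symm) (e l) :=
    ContMDiffAt.comp (e l) (by simpa only [Function.comp_apply, hll] using h3) h2
  have hd := mdifferentiable_chart (I := 𝓘(ℝ, E)) l
  have hd' := mdifferentiable_chart (I := 𝓘(ℝ, E')) (f l)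
  have hsurj : Function.Surjective (mfderiv 𝓘(ℝ, E) 𝓘(ℝ, E) e.symm (e l)) :=
    hd.symm.mfderiv_surjective (x := e l) (e.map_source hel)
  have hsurj' : Function.Surjective (mfderiv 𝓘(ℝ, E') 𝓘(ℝ, E') e' (f (e.symm (e l)))) := by
    rw [hll]; exact hd'.mfderiv_surjective hel'
  have hs' : Function.Surjective (mfderiv 𝓘(ℝ, E) 𝓘(ℝ, E') f (e.symm (e l))) := by
    rw [hll]; exact hs
  have hcomp : HasMFDerivAt 𝓘(ℝ, E) 𝓘(ℝ, E') (e' ∘ f ∘ e.symm) (e l) _ :=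
    HasMFDerivAt.comp (e l)
    (MDifferentiableAt.hasMFDerivAt
      (by simpa only [Function.comp_apply, hll] using h3.mdifferentiableAt (by simp)))
    (((hf.mdifferentiable (by simp) (e.symm (e l))).hasMFDerivAt).comp (e l)
      (h1.mdifferentiableAt (by simp)).hasMFDerivAt)
  -- Strict differentiability with onto differential gives openness in charts.
  have hst := hF.contDiffAt.hasStrictFDerivAt' hcomp.hasFDerivAt (by simp)
  have hmap := hst.map_nhds_eq_of_surj
    (LinearMap.range_eq_top.2 (hsurj'.comp (hs'.comp hsurj)))
  have he1 : Filter.map e (𝓝 l) = 𝓝 (e l) := e.map_nhds_eq hel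
  have he2 : Filter.map e'.symm (𝓝 (e' (f l))) = 𝓝 (f l) := by
    have := e'.symm.map_nhds_eq (e'.map_source hel')
    rwa [e'.left_inv hel'] at this
  rw [← he1, Filter.map_map] at hmap
  simp only [Function.comp_apply, hll] at hmap
  rw [← he2, ← hmap, Filter.map_map]
  refine Filter.map_congr ?_
  filter_upwards [e.open_source.mem_nhds hel,
    hf.continuous.continuousAt.preimage_mem_nhds (e'.open_source.mem_nhds hel')] with y hy hy'
  simp only [Function.comp_apply, e.left_inv hy]
  exact (e'.left_inv hy').symm

/-- A continuous map into an embedded submanifold is smooth if it is smooth as a map into the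
ambient manifold. -/
theorem contMDiff_of_comp_embedding {EX X : Type*} [NormedAddCommGroup EX] [NormedSpace ℝ EX]
    [TopologicalSpace X] [ChartedSpace EX X]
    [FiniteDimensional ℝ E] [IsManifold 𝓘(ℝ, E) ∞ L] [FiniteDimensional ℝ E']
    [IsManifold 𝓘(ℝ, E') ∞ N] {γ : L → N} (hγ : ContMDiff 𝓘(ℝ, E) 𝓘(ℝ, E') ∞ γ)
    (himm : ∀ t, Function.Injective (mfderiv 𝓘(ℝ, E) 𝓘(ℝ, E') γ t))
    (hemb : Topology.IsEmbedding γ) {σ : X → L}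
    (hσ : ContMDiff 𝓘(ℝ, EX) 𝓘(ℝ, E') ∞ (γ ∘ σ)) :
    ContMDiff 𝓘(ℝ, EX) 𝓘(ℝ, E) ∞ σ := by
  have hcont : Continuous σ := hemb.continuous_iff.2 hσ.continuous
  intro x
  -- An immersion has constant rank; with injectivity of `γ`, `c ∘ g` becomes a smooth local left
  -- inverse of `γ`, and `σ = c ∘ g ∘ (γ ∘ σ)` near `x`.
  obtain ⟨A, c, V, g, hA, hxA, hc, hcA, hV, hg, hgc, him⟩ :=
    exists_section_of_finrank_tangentImage_eq (r := Module.finrank ℝ E) hγ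
      (fun t => LinearMap.finrank_range_of_inj (himm t)) (σ x)
  have hleft : ∀ a ∈ A, γ a ∈ V ∧ c (g (γ a)) = a := by
    intro a ha
    obtain ⟨u, hu⟩ := him.subset ⟨a, ha, rfl⟩
    obtain rfl : c u = a := hemb.injective hu
    exact ⟨(hgc u).1, by rw [(hgc u).2]⟩
  have hsm : ContMDiffAt 𝓘(ℝ, EX) 𝓘(ℝ, E) ∞ (c ∘ g ∘ γ ∘ σ) x :=
    (hc _).comp x ((hg.contMDiffAt (hV.mem_nhds (hleft _ hxA).1)).comp x (hσ x))
  refine hsm.congr_of_eventuallyEq ?_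
  filter_upwards [(hA.preimage hcont).mem_nhds hxA] with y hy using (hleft _ hy).2.symm

end Manifolds

end DarbouxCauchy

/-! ### Annihilators of sums and reductions -/

namespace DarbouxCauchy

section Annihilators

variable {E H M : Type*} [NormedAddCommGroup E] [NormedSpace ℝ E] [TopologicalSpace H]
  {I : ModelWithCorners ℝ E H} [TopologicalSpace M] [ChartedSpace H M]
  {E' H' N : Type*} [NormedAddCommGroup E'] [NormedSpace ℝ E'] [TopologicalSpace H']
  {I' : ModelWithCorners ℝ E' H'} [TopologicalSpace N] [ChartedSpace H' N]

theorem derived_le (K : CoDistribution I M) (x : M) : derived K x ≤ K x := by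
  refine Submodule.span_le.2 ?_
  rintro _ ⟨U, θ, -, hx, -, h, rfl⟩
  exact (h x hx).1

/-- Finite-dimensional double annihilator, transported from the algebraic to the continuous dual. -/
theorem mem_of_forall_mem_ann [FiniteDimensional ℝ E] (K : CoDistribution I M) {x : M}
    {φ : Cotangent I x} (h : ∀ v ∈ ann K x, φ v = 0) : φ ∈ K x := by
  let T : (E →L[ℝ] ℝ) ≃ₗ[ℝ] (E →ₗ[ℝ] ℝ) := LinearMap.toContinuousLinearMap.symm
  let W : Submodule ℝ (Module.Dual ℝ E) := Submodule.map T.toLinearMap (K x)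
  have hW : T φ ∈ W := by
    rw [← Subspace.dualCoannihilator_dualAnnihilator_eq (W := W), Submodule.mem_dualAnnihilator]
    intro v hv
    rw [Submodule.mem_dualCoannihilator] at hv
    exact h v fun θ hθ => hv (T θ) ⟨θ, hθ, rfl⟩
  obtain ⟨θ, hθ, hθφ⟩ := hW
  exact T.injective hθφ ▸ hθ

/-- A covector pulled back by a projection only sees the corresponding component, so the conditions
decouple. -/
theorem mem_ann_sumSystem {K₁ : CoDistribution I M} {K₂ : CoDistribution I' N} {p : M × N}
    {v : E × E'} :
    (v : TangentSpace (I.prod I') p) ∈ ann (sumSystem K₁ K₂) p ↔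
      (v.1 : TangentSpace I p.1) ∈ ann K₁ p.1 ∧ (v.2 : TangentSpace I' p.2) ∈ ann K₂ p.2 := by
  have h1 : ∀ θ : Cotangent I p.1, (θ.comp (mfderiv (I.prod I') I Prod.fst p)) v = θ v.1 := by
    intro θ
    rw [mfderiv_fst]
    rfl
  have h2 : ∀ θ : Cotangent I' p.2, (θ.comp (mfderiv (I.prod I') I' Prod.snd p)) v = θ v.2 := by
    intro θ
    rw [mfderiv_snd]
    rfl
  constructor
  · intro h
    exact ⟨fun θ hθ => (h1 θ).symm.trans (h _ (Submodule.subset_span (Or.inl ⟨θ, hθ, rfl⟩))),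
      fun θ hθ => (h2 θ).symm.trans (h _ (Submodule.subset_span (Or.inr ⟨θ, hθ, rfl⟩)))⟩
  · rintro ⟨ha, hb⟩ φ hφ
    induction hφ using Submodule.span_induction with
    | mem φ hφ =>
      rcases hφ with ⟨θ, hθ, rfl⟩ | ⟨θ, hθ, rfl⟩
      · exact (h1 θ).trans (ha θ hθ)
      · exact (h2 θ).trans (hb θ hθ)
    | zero => rfl
    | add φ ψ _ _ h h' => exact (congrArg₂ (· + ·) h h').trans (add_zero 0)
    | smul c φ _ h => exact (congrArg (c • ·) h).trans (smul_zero c)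

/-- Covectors separate vectors. A full cotangent factor in a sum system therefore forces that
component of an annihilated vector to vanish. -/
theorem mem_ann_top {x : M} {v : E} :
    (v : TangentSpace I x) ∈ ann (fun _ => ⊤ : CoDistribution I M) x ↔ v = 0 := by
  constructor
  · intro h
    by_contra hv
    obtain ⟨g, hg⟩ := SeparatingDual.exists_ne_zero (R := ℝ) hv
    exact hg (h g trivial)
  · rintro rfl θ _
    exact map_zero θ

/-- The annihilator of a reduction is the image of the annihilator. -/
theorem mem_ann_of_isReduction [FiniteDimensional ℝ E] [FiniteDimensional ℝ E'] {q : N → M}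
    {J : CoDistribution I' N} {K : CoDistribution I M} (h : IsReduction q J K) (y : N)
    {w : TangentSpace I (q y)} :
    w ∈ ann K (q y) ↔ ∃ v ∈ ann J y, mfderiv I' I q y v = w := by
  constructor
  · intro hw
    let D : E' →L[ℝ] E := mfderiv I' I q y
    let A : Submodule ℝ E' := ann J y
    change (w : E) ∈ A.map D.toLinearMap
    -- A functional killing the image of `ann J` but not `w` pulls back into `J` by the double
    -- annihilator, so it lies in `K` and must kill `w`.
    by_contra hwA
    obtain ⟨φ, hφw, hφ⟩ := Submodule.exists_le_ker_of_notMem hwA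
    let θ : E →L[ℝ] ℝ := LinearMap.toContinuousLinearMap φ
    refine hφw (hw θ ((h y θ).2 (mem_of_forall_mem_ann J fun v hv => ?_)))
    exact hφ ⟨v, hv, rfl⟩
  · rintro ⟨v, hv, rfl⟩ θ hθ
    exact hv _ ((h y θ).1 hθ)

end Annihilators

end DarbouxCauchy

/-! ### The rank count and the embedded pieces -/

namespace DarbouxCauchy

theorem finrank_map_of_injOn {X Y : Type*} [AddCommGroup X] [Module ℝ X] [AddCommGroup Y]
    [Module ℝ Y] (D : X →ₗ[ℝ] Y) (W : Submodule ℝ X) (h : ∀ v ∈ W, D v = 0 → v = 0) :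
    Module.finrank ℝ (W.map D) = Module.finrank ℝ W := by
  rw [← LinearMap.range_domRestrict]
  refine LinearMap.finrank_range_of_inj ((injective_iff_map_eq_zero _).2 fun v hv => ?_)
  exact Subtype.ext (h v v.2 hv)

/-- If `D` restricts to an isomorphism of `A` onto a space containing `T`, then the image under
`P` of the lift of `T` to `A` has the codimension in `T` of the vectors that lift to `ker P`. -/
theorem finrank_map_lift_add_finrank {X Y Z : Type*} [AddCommGroup X] [Module ℝ X]
    [FiniteDimensional ℝ X] [AddCommGroup Y] [Module ℝ Y] [AddCommGroup Z] [Module ℝ Z]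
    (D : X →ₗ[ℝ] Y) (P : X →ₗ[ℝ] Z) {A V : Submodule ℝ X} {T B : Submodule ℝ Y}
    (hD : ∀ v ∈ A, D v = 0 → v = 0) (hV : ∀ v, v ∈ V ↔ v ∈ A ∧ D v ∈ T)
    (hT : ∀ w ∈ T, ∃ v ∈ A, D v = w) (hB : ∀ w, w ∈ B ↔ ∃ v ∈ A, P v = 0 ∧ D v = w) :
    Module.finrank ℝ (V.map P) + Module.finrank ℝ ↥(T ⊓ B) = Module.finrank ℝ T := by
  have h1 : V.map D = T := by
    ext w
    constructor
    · rintro ⟨v, hv, rfl⟩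
      exact ((hV v).1 hv).2
    · intro hw
      obtain ⟨v, hv, rfl⟩ := hT w hw
      exact ⟨v, (hV v).2 ⟨hv, hw⟩, rfl⟩
  have h2 : (V ⊓ LinearMap.ker P).map D = T ⊓ B := by
    ext w
    constructor
    · rintro ⟨v, ⟨hv, hvP⟩, rfl⟩
      exact ⟨((hV v).1 hv).2, (hB _).2 ⟨v, ((hV v).1 hv).1, hvP, rfl⟩⟩
    · rintro ⟨hw, hwB⟩
      obtain ⟨v, hv, hvP, rfl⟩ := (hB w).1 hwB
      exact ⟨v, ⟨(hV v).2 ⟨hv, hw⟩, hvP⟩, rfl⟩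
  have hDV : ∀ v ∈ V, D v = 0 → v = 0 := fun v hv => hD v ((hV v).1 hv).1
  -- Rank-nullity for `P` on `V`; `D` carries `V` to `T` and the kernel to `T ⊓ B` without loss of
  -- dimension.
  have h3 := (P.domRestrict V).finrank_range_add_finrank_ker
  have h4 : Module.finrank ℝ (LinearMap.ker (P.domRestrict V)) =
      Module.finrank ℝ ↥(V ⊓ LinearMap.ker P) := by
    rw [LinearMap.ker_domRestrict, ← Submodule.finrank_map_subtype_eq V,
      Submodule.map_comap_subtype]
  rw [LinearMap.range_domRestrict, h4,
    ← finrank_map_of_injOn D (V ⊓ LinearMap.ker P) fun v hv => hDV v hv.1, h2,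
    ← finrank_map_of_injOn D V hDV, h1] at h3
  exact h3

/-- About each point, the image of a map of constant rank tangent to `ann K` is an embedded
integral manifold of `K`. -/
theorem exists_embedded_integralManifold_of_finrank_tangentImage_eq {E L E' N : Type*}
    [NormedAddCommGroup E] [NormedSpace ℝ E] [FiniteDimensional ℝ E]
    [TopologicalSpace L] [ChartedSpace E L] [IsManifold 𝓘(ℝ, E) ∞ L]
    [NormedAddCommGroup E'] [NormedSpace ℝ E'] [FiniteDimensional ℝ E']
    [TopologicalSpace N] [ChartedSpace E' N] [IsManifold 𝓘(ℝ, E') ∞ N]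
    {K : CoDistribution 𝓘(ℝ, E') N} {f : L → N} {r : ℕ}
    (hf : ContMDiff 𝓘(ℝ, E) 𝓘(ℝ, E') ∞ f)
    (hr : ∀ l, Module.finrank ℝ (tangentImage 𝓘(ℝ, E) 𝓘(ℝ, E') f l) = r)
    (hK : ∀ l, tangentImage 𝓘(ℝ, E) 𝓘(ℝ, E') f l ≤ ann K (f l)) (l : L) :
    ∃ (A : Set L) (j : EuclideanSpace ℝ (Fin r) → N),
      IsOpen A ∧ l ∈ A ∧ Set.range j = f '' A ∧ Topology.IsEmbedding j ∧
        IsIntegralManifold (𝓡 r) K j := by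
  obtain ⟨A, c, V, g, hA, hlA, hc, -, hV, hg, hgc, him⟩ :=
    exists_section_of_finrank_tangentImage_eq hf hr l
  have hfc := hf.comp hc
  refine ⟨A, f ∘ c, hA, hlA, him.symm,
    isEmbedding_of_leftInverse_of_continuousOn hfc.continuous hg.continuousOn
      (fun u => (hgc u).1) fun u => (hgc u).2, hfc,
    mfderiv_injective_of_leftInverse hfc hV hg (fun u => (hgc u).1) fun u => (hgc u).2, ?_⟩
  rintro u _ ⟨v, rfl⟩
  refine hK (c u) ⟨mfderiv (𝓡 r) 𝓘(ℝ, E) c u v, ?_⟩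
  exact (DFunLike.congr_fun (mfderiv_comp u (hf.mdifferentiable (by simp) (c u))
    (hc.mdifferentiable (by simp) u)) v).symm

/-! ### Projecting products of integral manifolds -/

section Reduction

variable {E M E₁ M₁ E₂ M₂ : Type*}
  [NormedAddCommGroup E] [NormedSpace ℝ E]
  [TopologicalSpace M] [ChartedSpace E M]
  [NormedAddCommGroup E₁] [NormedSpace ℝ E₁]
  [TopologicalSpace M₁] [ChartedSpace E₁ M₁]
  [NormedAddCommGroup E₂] [NormedSpace ℝ E₂]
  [TopologicalSpace M₂] [ChartedSpace E₂ M₂]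
  {K₁ : CoDistribution 𝓘(ℝ, E₁) M₁} {K₂ : CoDistribution 𝓘(ℝ, E₂) M₂} {q : M₁ × M₂ → M}

/-- Smaller systems have larger annihilators, so transversality to the derived systems implies
transversality to `K₁ + K₂`. Both the rank count and the immersion property of `s` rest on this. -/
theorem eq_zero_of_mem_ann_sumSystem_of_isTransverse
    (h : IsTransverse 𝓘(ℝ, E) q (sumSystem (derived K₁) (derived K₂))) {y : M₁ × M₂}
    {v : E₁ × E₂} (hv : v ∈ ann (sumSystem K₁ K₂) y)
    (hq : (mfderiv (𝓘(ℝ, E₁).prod 𝓘(ℝ, E₂)) 𝓘(ℝ, E) q y v : E) = 0) : v = 0 := by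
  have hv' := mem_ann_sumSystem.1 hv
  exact (h y).le ⟨hq, mem_ann_sumSystem.2
    ⟨fun θ hθ => hv'.1 θ (derived_le K₁ _ hθ), fun θ hθ => hv'.2 θ (derived_le K₂ _ hθ)⟩⟩

/-- The product of integral manifolds of `K₁` and `K₂` projects to an integral manifold of the
reduction of `K₁ + K₂`. -/
theorem IsIntegralManifold.comp_prodMap {X₁ X₂ : Type*}
    [FiniteDimensional ℝ E] [FiniteDimensional ℝ E₁] [FiniteDimensional ℝ E₂]
    [NormedAddCommGroup X₁] [NormedSpace ℝ X₁] [NormedAddCommGroup X₂] [NormedSpace ℝ X₂]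
    {K : CoDistribution 𝓘(ℝ, E) M}
    (hq : ContMDiff (𝓘(ℝ, E₁).prod 𝓘(ℝ, E₂)) 𝓘(ℝ, E) ∞ q)
    (htr : IsTransverse 𝓘(ℝ, E) q (sumSystem (derived K₁) (derived K₂)))
    (hred : IsReduction q (sumSystem K₁ K₂) K) {j₁ : X₁ → M₁} {j₂ : X₂ → M₂}
    (h₁ : IsIntegralManifold 𝓘(ℝ, X₁) K₁ j₁) (h₂ : IsIntegralManifold 𝓘(ℝ, X₂) K₂ j₂) :
    IsIntegralManifold (𝓘(ℝ, X₁).prod 𝓘(ℝ, X₂)) K (fun t : X₁ × X₂ => q (j₁ t.1, j₂ t.2)) := by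
  have hd : ∀ t : X₁ × X₂, ∀ v : X₁ × X₂,
      (mfderiv (𝓘(ℝ, X₁).prod 𝓘(ℝ, X₂)) 𝓘(ℝ, E) (fun t : X₁ × X₂ => q (j₁ t.1, j₂ t.2)) t v : E) =
      mfderiv (𝓘(ℝ, E₁).prod 𝓘(ℝ, E₂)) 𝓘(ℝ, E) q (j₁ t.1, j₂ t.2)
        ((mfderiv 𝓘(ℝ, X₁) 𝓘(ℝ, E₁) j₁ t.1 v.1, mfderiv 𝓘(ℝ, X₂) 𝓘(ℝ, E₂) j₂ t.2 v.2) :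
          E₁ × E₂) := by
    intro t v
    have h := ((hq.mdifferentiable (by simp) (Prod.map j₁ j₂ t)).hasMFDerivAt.comp t
      (HasMFDerivAt.prodMap (p := t) (h₁.smooth.mdifferentiable (by simp) t.1).hasMFDerivAt
        (h₂.smooth.mdifferentiable (by simp) t.2).hasMFDerivAt)).mfderiv
    exact DFunLike.congr_fun h v
  have hmem : ∀ t : X₁ × X₂, ∀ v : X₁ × X₂,
      (((mfderiv 𝓘(ℝ, X₁) 𝓘(ℝ, E₁) j₁ t.1 v.1, mfderiv 𝓘(ℝ, X₂) 𝓘(ℝ, E₂) j₂ t.2 v.2) :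
        E₁ × E₂)) ∈ ann (sumSystem K₁ K₂) (j₁ t.1, j₂ t.2) := fun t v =>
    mem_ann_sumSystem.2 ⟨h₁.integral t.1 ⟨v.1, rfl⟩, h₂.integral t.2 ⟨v.2, rfl⟩⟩
  refine ⟨hq.comp ((h₁.smooth.comp contMDiff_fst).prodMk (h₂.smooth.comp contMDiff_snd)), ?_, ?_⟩
  · intro t
    refine (injective_iff_map_eq_zero _).2 fun v hv => ?_
    have h0 := eq_zero_of_mem_ann_sumSystem_of_isTransverse htr (hmem t v) ((hd t v).symm.trans hv)
    exact Prod.ext ((injective_iff_map_eq_zero _).1 (h₁.immersion t.1) _ (congrArg Prod.fst h0))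
      ((injective_iff_map_eq_zero _).1 (h₂.immersion t.2) _ (congrArg Prod.snd h0))
  · rintro t _ ⟨v, rfl⟩
    exact (mem_ann_of_isReduction hred _).2 ⟨_, hmem t v, (hd t v).symm⟩

end Reduction

end DarbouxCauchy

/-! ### The main theorem -/

open DarbouxCauchy in
theorem theorem5p7
    {EG G E M E₁ M₁ E₂ M₂ F₁ Q₁ F₂ Q₂ S EL L : Type*}
    -- the Lie group `G`
    [NormedAddCommGroup EG] [NormedSpace ℝ EG] [FiniteDimensional ℝ EG]
    [TopologicalSpace G] [ChartedSpace EG G] [Group G] [LieGroup 𝓘(ℝ, EG) ∞ G]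
    [T2Space G] [SecondCountableTopology G]
    -- the manifold `M`
    [NormedAddCommGroup E] [NormedSpace ℝ E] [FiniteDimensional ℝ E]
    [TopologicalSpace M] [ChartedSpace E M] [IsManifold 𝓘(ℝ, E) ∞ M]
    [T2Space M] [SecondCountableTopology M]
    -- the manifolds `M₁` and `M₂`
    [NormedAddCommGroup E₁] [NormedSpace ℝ E₁] [FiniteDimensional ℝ E₁]
    [TopologicalSpace M₁] [ChartedSpace E₁ M₁] [IsManifold 𝓘(ℝ, E₁) ∞ M₁]
    [T2Space M₁] [SecondCountableTopology M₁]
    [NormedAddCommGroup E₂] [NormedSpace ℝ E₂] [FiniteDimensional ℝ E₂]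
    [TopologicalSpace M₂] [ChartedSpace E₂ M₂] [IsManifold 𝓘(ℝ, E₂) ∞ M₂]
    [T2Space M₂] [SecondCountableTopology M₂]
    -- the quotients `Q₁ = M₁/G` and `Q₂ = M₂/G`
    [NormedAddCommGroup F₁] [NormedSpace ℝ F₁] [FiniteDimensional ℝ F₁]
    [TopologicalSpace Q₁] [ChartedSpace F₁ Q₁] [IsManifold 𝓘(ℝ, F₁) ∞ Q₁]
    [T2Space Q₁] [SecondCountableTopology Q₁]
    [NormedAddCommGroup F₂] [NormedSpace ℝ F₂] [FiniteDimensional ℝ F₂]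
    [TopologicalSpace Q₂] [ChartedSpace F₂ Q₂] [IsManifold 𝓘(ℝ, F₂) ∞ Q₂]
    [T2Space Q₂] [SecondCountableTopology Q₂]
    (n₁ p₁ n₂ p₂ : ℕ)
    -- the decomposable Darboux integrable system `K` on `M`
    (K Vhat Vcheck : CoDistribution 𝓘(ℝ, E) M)
    (hK : IsPfaffian K)
    (hdec : IsDecomposable n₁ p₁ n₂ p₂ K Vhat Vcheck)
    (hDI : IsDarbouxIntegrable K Vhat Vcheck)
    -- its canonical quotient representation
    (a₁ : LocalAction 𝓘(ℝ, EG) 𝓘(ℝ, E₁) G M₁) (a₂ : LocalAction 𝓘(ℝ, EG) 𝓘(ℝ, E₂) G M₂)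
    (K₁ : CoDistribution 𝓘(ℝ, E₁) M₁) (K₂ : CoDistribution 𝓘(ℝ, E₂) M₂)
    (q₁ : M₁ → Q₁) (q₂ : M₂ → Q₂) (q : M₁ × M₂ → M)
    (hrep : IsQuotientRepresentation F₁ F₂ K Vhat Vcheck a₁ a₂ K₁ K₂ q₁ q₂ q)
    -- the embedded non-characteristic `(n₁ + n₂ - 1)`-dimensional integral manifold `γ : S → M`
    [TopologicalSpace S] [ChartedSpace (EuclideanSpace ℝ (Fin (n₁ + n₂ - 1))) S]
    [IsManifold (𝓡 (n₁ + n₂ - 1)) ∞ S] [T2Space S] [SecondCountableTopology S]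
    (γ : S → M) (hγ : IsIntegralManifold (𝓡 (n₁ + n₂ - 1)) K γ)
    (hγemb : Topology.IsEmbedding γ)
    (hγnc : IsNonCharacteristic (𝓡 (n₁ + n₂ - 1)) n₁ n₂ Vhat Vcheck γ)
    -- the lift `ι : L → M₁ × M₂`
    [NormedAddCommGroup EL] [NormedSpace ℝ EL] [FiniteDimensional ℝ EL]
    [TopologicalSpace L] [ChartedSpace EL L] [IsManifold 𝓘(ℝ, EL) ∞ L]
    [T2Space L] [SecondCountableTopology L]
    (ι : L → M₁ × M₂)
    (hι : IsLift (𝓡 (n₁ + n₂ - 1)) 𝓘(ℝ, EL) 𝓘(ℝ, E) (sumSystem K₁ K₂) q γ ι) :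
    -- about every `l ∈ L`, embedded parametrizations `j₁ l`, `j₂ l` of pieces of `π₁(L)`, `π₂(L)`
    ∃ (A₁ A₂ : L → Set L)
      (j₁ : L → EuclideanSpace ℝ (Fin n₂) → M₁) (j₂ : L → EuclideanSpace ℝ (Fin n₁) → M₂),
      (∀ l, IsOpen (A₁ l) ∧ l ∈ A₁ l ∧ Set.range (j₁ l) = (fun l' => (ι l').1) '' A₁ l ∧
        Topology.IsEmbedding (j₁ l) ∧ IsIntegralManifold (𝓡 n₂) K₁ (j₁ l)) ∧
      (∀ l, IsOpen (A₂ l) ∧ l ∈ A₂ l ∧ Set.range (j₂ l) = (fun l' => (ι l').2) '' A₂ l ∧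
        Topology.IsEmbedding (j₂ l) ∧ IsIntegralManifold (𝓡 n₁) K₂ (j₂ l)) ∧
      -- `s = q` on `L₁ × L₂` is an `(n₁ + n₂)`-dimensional integral manifold
      (∀ l l', IsIntegralManifold ((𝓡 n₂).prod (𝓡 n₁)) K
        (fun t : EuclideanSpace ℝ (Fin n₂) × EuclideanSpace ℝ (Fin n₁) =>
          q (j₁ l t.1, j₂ l' t.2))) ∧
      -- `s` solves the local Cauchy problem about `q (ι l)`
      (∀ l, SolvesLocalCauchy ((𝓡 n₂).prod (𝓡 n₁)) K (Set.range γ) (q (ι l))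
        (fun t : EuclideanSpace ℝ (Fin n₂) × EuclideanSpace ℝ (Fin n₁) =>
          q (j₁ l t.1, j₂ l t.2))) := by
  have hqs := hrep.regular_diag.smooth
  have hqd := hqs.mdifferentiable (by simp)
  have hιs := hι.integral.smooth
  have hιd := hιs.mdifferentiable (by simp)
  have hγd := hγ.smooth.mdifferentiable (by simp)
  choose σ hσ using hι.mem
  have hcomp : γ ∘ σ = q ∘ ι := funext hσ
  have hσs : ContMDiff 𝓘(ℝ, EL) (𝓡 (n₁ + n₂ - 1)) ∞ σ :=
    contMDiff_of_comp_embedding hγ.smooth hγ.immersion hγemb (hcomp ▸ hqs.comp hιs)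
  have hdσ : ∀ l, ∀ v : EL,
      (mfderiv (𝓡 (n₁ + n₂ - 1)) 𝓘(ℝ, E) γ (σ l)
        (mfderiv 𝓘(ℝ, EL) (𝓡 (n₁ + n₂ - 1)) σ l v) : E) =
      mfderiv (𝓘(ℝ, E₁).prod 𝓘(ℝ, E₂)) 𝓘(ℝ, E) q (ι l)
        (mfderiv 𝓘(ℝ, EL) (𝓘(ℝ, E₁).prod 𝓘(ℝ, E₂)) ι l v) := by
    intro l v
    have h1 := (hγd (σ l)).hasMFDerivAt.comp l
      (hσs.mdifferentiable (by simp) l).hasMFDerivAt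
    have h2 := (hqd (ι l)).hasMFDerivAt.comp l (hιd l).hasMFDerivAt
    have h3 := h1.mfderiv
    have h4 := h2.mfderiv
    have h5 : ∀ f g : L → M, f = g → (mfderiv 𝓘(ℝ, EL) 𝓘(ℝ, E) f l v : E) =
        mfderiv 𝓘(ℝ, EL) 𝓘(ℝ, E) g l v := by rintro f _ rfl; rfl
    exact (DFunLike.congr_fun h3 v).symm.trans ((h5 _ _ hcomp).trans (DFunLike.congr_fun h4 v))
  -- The base points `γ (σ l)` and `q (ι l)` are only propositionally equal; all tangent spaces are
  -- read as `E` to pass between them.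
  have hann : ∀ (J : CoDistribution 𝓘(ℝ, E) M) l (w : E),
      (w : TangentSpace 𝓘(ℝ, E) (γ (σ l))) ∈ ann J (γ (σ l)) ↔
        (w : TangentSpace 𝓘(ℝ, E) (q (ι l))) ∈ ann J (q (ι l)) := by
    intro J l w
    have : ∀ x y : M, x = y → ((w : TangentSpace 𝓘(ℝ, E) x) ∈ ann J x ↔
        (w : TangentSpace 𝓘(ℝ, E) y) ∈ ann J y) := by rintro x _ rfl; rfl
    exact this _ _ (hσ l)
  -- linear algebra at a point of `L`
  have hinj : ∀ l, ∀ v : E₁ × E₂, v ∈ ann (sumSystem K₁ K₂) (ι l) →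
      (mfderiv (𝓘(ℝ, E₁).prod 𝓘(ℝ, E₂)) 𝓘(ℝ, E) q (ι l) v : E) = 0 → v = 0 := fun l v =>
    eq_zero_of_mem_ann_sumSystem_of_isTransverse hrep.transverse_diag
  -- Integrality gives one inclusion, fullness of the lift the other.
  have htan : ∀ l, ∀ v : E₁ × E₂,
      v ∈ tangentImage 𝓘(ℝ, EL) (𝓘(ℝ, E₁).prod 𝓘(ℝ, E₂)) ι l ↔
        v ∈ ann (sumSystem K₁ K₂) (ι l) ∧
        (mfderiv (𝓘(ℝ, E₁).prod 𝓘(ℝ, E₂)) 𝓘(ℝ, E) q (ι l) v : E) ∈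
          tangentImage (𝓡 (n₁ + n₂ - 1)) 𝓘(ℝ, E) γ (σ l) := by
    intro l v
    constructor
    · rintro ⟨u, rfl⟩
      exact ⟨hι.integral.integral l ⟨u, rfl⟩, _, hdσ l u⟩
    · rintro ⟨hv, w, hw⟩
      exact hι.full l v hv ⟨σ l, w, hσ l, hw⟩
  have hlift : ∀ l, ∀ w : E, w ∈ tangentImage (𝓡 (n₁ + n₂ - 1)) 𝓘(ℝ, E) γ (σ l) →
      ∃ v : E₁ × E₂, v ∈ ann (sumSystem K₁ K₂) (ι l) ∧
        (mfderiv (𝓘(ℝ, E₁).prod 𝓘(ℝ, E₂)) 𝓘(ℝ, E) q (ι l) v : E) = w := fun l w hw =>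
    (mem_ann_of_isReduction hrep.reduction (ι l)).1 ((hann K l w).1 (hγ.integral (σ l) hw))
  have hT : ∀ l, Module.finrank ℝ (tangentImage (𝓡 (n₁ + n₂ - 1)) 𝓘(ℝ, E) γ (σ l)) =
      n₁ + n₂ - 1 := fun l =>
    (LinearMap.finrank_range_of_inj (hγ.immersion (σ l))).trans finrank_euclideanSpace_fin
  -- the projections of `L`
  have hs₁ : ContMDiff 𝓘(ℝ, EL) 𝓘(ℝ, E₁) ∞ (fun l => (ι l).1) := contMDiff_fst.comp hιs
  have hs₂ : ContMDiff 𝓘(ℝ, EL) 𝓘(ℝ, E₂) ∞ (fun l => (ι l).2) := contMDiff_snd.comp hιs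
  have hd₁ : ∀ l, ∀ v : EL, (mfderiv 𝓘(ℝ, EL) 𝓘(ℝ, E₁) (fun l => (ι l).1) l v : E₁) =
      (mfderiv 𝓘(ℝ, EL) (𝓘(ℝ, E₁).prod 𝓘(ℝ, E₂)) ι l v : E₁ × E₂).1 := fun l v =>
    DFunLike.congr_fun ((hasMFDerivAt_fst (ι l)).comp l (hιd l).hasMFDerivAt).mfderiv v
  have hd₂ : ∀ l, ∀ v : EL, (mfderiv 𝓘(ℝ, EL) 𝓘(ℝ, E₂) (fun l => (ι l).2) l v : E₂) =
      (mfderiv 𝓘(ℝ, EL) (𝓘(ℝ, E₁).prod 𝓘(ℝ, E₂)) ι l v : E₁ × E₂).2 := fun l v =>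
    DFunLike.congr_fun ((hasMFDerivAt_snd (ι l)).comp l (hιd l).hasMFDerivAt).mfderiv v
  have hr₁ : ∀ l, Module.finrank ℝ
      (tangentImage 𝓘(ℝ, EL) 𝓘(ℝ, E₁) (fun l => (ι l).1) l) = n₂ := by
    intro l
    let D : E₁ × E₂ →L[ℝ] E := mfderiv (𝓘(ℝ, E₁).prod 𝓘(ℝ, E₂)) 𝓘(ℝ, E) q (ι l)
    let V : Submodule ℝ (E₁ × E₂) := tangentImage 𝓘(ℝ, EL) (𝓘(ℝ, E₁).prod 𝓘(ℝ, E₂)) ι l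
    let T : Submodule ℝ E := tangentImage (𝓡 (n₁ + n₂ - 1)) 𝓘(ℝ, E) γ (σ l)
    let B : Submodule ℝ E := ann Vcheck (γ (σ l))
    -- `ann Vcheck` is the image of `0 ⊕ ann K₂`, which is the kernel of `π₁` inside `ann K₁ ⊕ ann
    -- K₂`.
    have hB : ∀ w : E, w ∈ B ↔ ∃ v : E₁ × E₂, v ∈ ann (sumSystem K₁ K₂) (ι l) ∧
        LinearMap.fst ℝ E₁ E₂ v = 0 ∧ D.toLinearMap v = w := by
      intro w
      refine (hann Vcheck l w).trans ((mem_ann_of_isReduction hrep.reduction_check _).trans ?_)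
      constructor
      · rintro ⟨v, hv, hw⟩
        have hv' := mem_ann_sumSystem.1 hv
        have h0 := mem_ann_top.1 hv'.1
        exact ⟨v, mem_ann_sumSystem.2 ⟨fun θ _ => (congrArg θ h0).trans (map_zero θ), hv'.2⟩,
          h0, hw⟩
      · rintro ⟨v, hv, h0, hw⟩
        exact ⟨v, mem_ann_sumSystem.2 ⟨mem_ann_top.2 h0, (mem_ann_sumSystem.1 hv).2⟩, hw⟩
    have h := finrank_map_lift_add_finrank D.toLinearMap (LinearMap.fst ℝ E₁ E₂)
      (V := V) (T := T) (B := B) (hinj l) (htan l) (hlift l) hB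
    have hmap : V.map (LinearMap.fst ℝ E₁ E₂) =
        tangentImage 𝓘(ℝ, EL) 𝓘(ℝ, E₁) (fun l => (ι l).1) l := by
      ext w
      constructor
      · rintro ⟨_, ⟨u, rfl⟩, rfl⟩
        exact ⟨u, hd₁ l u⟩
      · rintro ⟨u, rfl⟩
        exact ⟨_, ⟨u, rfl⟩, (hd₁ l u).symm⟩
    have h1 : Module.finrank ℝ ↥(T ⊓ B) + 1 = n₁ := (hγnc (σ l)).2
    have h2 : Module.finrank ℝ T = n₁ + n₂ - 1 := hT l
    have h3 := hdec.n₂_pos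
    -- The count is `(n₁ + n₂ - 1) - (n₁ - 1) = n₂`; `h1` forces `n₁ ≥ 1`, so the truncated
    -- subtractions are genuine.
    refine (congrArg (fun W : Submodule ℝ E₁ => Module.finrank ℝ W) hmap).symm.trans ?_
    omega
  have hr₂ : ∀ l, Module.finrank ℝ
      (tangentImage 𝓘(ℝ, EL) 𝓘(ℝ, E₂) (fun l => (ι l).2) l) = n₁ := by
    intro l
    let D : E₁ × E₂ →L[ℝ] E := mfderiv (𝓘(ℝ, E₁).prod 𝓘(ℝ, E₂)) 𝓘(ℝ, E) q (ι l)
    let V : Submodule ℝ (E₁ × E₂) := tangentImage 𝓘(ℝ, EL) (𝓘(ℝ, E₁).prod 𝓘(ℝ, E₂)) ι l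
    let T : Submodule ℝ E := tangentImage (𝓡 (n₁ + n₂ - 1)) 𝓘(ℝ, E) γ (σ l)
    let B : Submodule ℝ E := ann Vhat (γ (σ l))
    have hB : ∀ w : E, w ∈ B ↔ ∃ v : E₁ × E₂, v ∈ ann (sumSystem K₁ K₂) (ι l) ∧
        LinearMap.snd ℝ E₁ E₂ v = 0 ∧ D.toLinearMap v = w := by
      intro w
      refine (hann Vhat l w).trans ((mem_ann_of_isReduction hrep.reduction_hat _).trans ?_)
      constructor
      · rintro ⟨v, hv, hw⟩
        have hv' := mem_ann_sumSystem.1 hv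
        have h0 := mem_ann_top.1 hv'.2
        exact ⟨v, mem_ann_sumSystem.2 ⟨hv'.1, fun θ _ => (congrArg θ h0).trans (map_zero θ)⟩,
          h0, hw⟩
      · rintro ⟨v, hv, h0, hw⟩
        exact ⟨v, mem_ann_sumSystem.2 ⟨(mem_ann_sumSystem.1 hv).1, mem_ann_top.2 h0⟩, hw⟩
    have h := finrank_map_lift_add_finrank D.toLinearMap (LinearMap.snd ℝ E₁ E₂)
      (V := V) (T := T) (B := B) (hinj l) (htan l) (hlift l) hB
    have hmap : V.map (LinearMap.snd ℝ E₁ E₂) =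
        tangentImage 𝓘(ℝ, EL) 𝓘(ℝ, E₂) (fun l => (ι l).2) l := by
      ext w
      constructor
      · rintro ⟨_, ⟨u, rfl⟩, rfl⟩
        exact ⟨u, hd₂ l u⟩
      · rintro ⟨u, rfl⟩
        exact ⟨_, ⟨u, rfl⟩, (hd₂ l u).symm⟩
    have h1 : Module.finrank ℝ ↥(T ⊓ B) + 1 = n₂ := (hγnc (σ l)).1
    have h2 : Module.finrank ℝ T = n₁ + n₂ - 1 := hT l
    have h3 := hdec.n₁_pos
    refine (congrArg (fun W : Submodule ℝ E₂ => Module.finrank ℝ W) hmap).symm.trans ?_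
    omega
  have hK₁ : ∀ l, tangentImage 𝓘(ℝ, EL) 𝓘(ℝ, E₁) (fun l => (ι l).1) l ≤ ann K₁ (ι l).1 := by
    rintro l _ ⟨u, rfl⟩
    have h := (mem_ann_sumSystem.1 (hι.integral.integral l ⟨u, rfl⟩)).1
    exact fun θ hθ => (congrArg θ (hd₁ l u)).trans (h θ hθ)
  have hK₂ : ∀ l, tangentImage 𝓘(ℝ, EL) 𝓘(ℝ, E₂) (fun l => (ι l).2) l ≤ ann K₂ (ι l).2 := by
    rintro l _ ⟨u, rfl⟩
    have h := (mem_ann_sumSystem.1 (hι.integral.integral l ⟨u, rfl⟩)).2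
    exact fun θ hθ => (congrArg θ (hd₂ l u)).trans (h θ hθ)
  choose A₁ j₁ hA₁ hl₁ hj₁ hemb₁ hint₁ using
    exists_embedded_integralManifold_of_finrank_tangentImage_eq hs₁ hr₁ hK₁
  choose A₂ j₂ hA₂ hl₂ hj₂ hemb₂ hint₂ using
    exists_embedded_integralManifold_of_finrank_tangentImage_eq hs₂ hr₂ hK₂
  have hint : ∀ l l', IsIntegralManifold ((𝓡 n₂).prod (𝓡 n₁)) K
      (fun t : EuclideanSpace ℝ (Fin n₂) × EuclideanSpace ℝ (Fin n₁) =>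
        q (j₁ l t.1, j₂ l' t.2)) := fun l l' =>
    (hint₁ l).comp_prodMap hqs hrep.transverse_diag hrep.reduction (hint₂ l')
  refine ⟨A₁, A₂, j₁, j₂, fun l => ⟨hA₁ l, hl₁ l, hj₁ l, hemb₁ l, hint₁ l⟩,
    fun l => ⟨hA₂ l, hl₂ l, hj₂ l, hemb₂ l, hint₂ l⟩, hint, fun l => ⟨hint l l, ?_⟩⟩
  -- `σ : L → S` is open, hence `s` covers a neighbourhood of `q (ι l)` in `S`
  have hsurj : Function.Surjective (mfderiv 𝓘(ℝ, EL) (𝓡 (n₁ + n₂ - 1)) σ l) := by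
    intro w
    -- A tangent vector of `S` lifts to `ann(K₁ + K₂)`; fullness puts the lift in the tangent space
    -- of `L`, and injectivity of the differential of `γ` identifies its image.
    obtain ⟨v, hv, hw⟩ := hlift l _ ⟨w, rfl⟩
    obtain ⟨u, rfl⟩ := (htan l v).2 ⟨hv, w, hw.symm⟩
    exact ⟨u, hγ.immersion (σ l) ((hdσ l u).trans hw)⟩
  -- The intersection lets a single `l'` supply both factors of a preimage under `s`.
  have hnhds : σ '' (A₁ l ∩ A₂ l) ∈ 𝓝 (σ l) := by
    rw [← map_nhds_eq_of_mfderiv_surjective hσs hsurj]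
    exact Filter.image_mem_map (((hA₁ l).inter (hA₂ l)).mem_nhds ⟨hl₁ l, hl₂ l⟩)
  -- Embeddedness of `S` turns a neighbourhood in `S` into the trace of one in `M`.
  rw [hγemb.nhds_eq_comap] at hnhds
  obtain ⟨W, hW, hWσ⟩ := hnhds
  obtain ⟨U, hUW, hU, hlU⟩ := mem_nhds_iff.1 hW
  refine ⟨U, hU, hσ l ▸ hlU, ?_⟩
  rintro _ ⟨⟨s, rfl⟩, hsU⟩
  obtain ⟨l', ⟨h₁, h₂⟩, rfl⟩ := hWσ (hUW hsU)
  obtain ⟨t₁, ht₁⟩ := (hj₁ l).ge ⟨l', h₁, rfl⟩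
  obtain ⟨t₂, ht₂⟩ := (hj₂ l).ge ⟨l', h₂, rfl⟩
  have hq : q (j₁ l t₁, j₂ l t₂) = γ (σ l') := by rw [ht₁, ht₂, hσ l']
  exact ⟨(t₁, t₂), by simpa only [Set.mem_preimage, hq] using hsU, hq⟩
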